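/- Let $d\ge 2$, let $(p,x)\mapsto px$ be a nondegenerate symmetric bilinear form on $\mathbb R^d$ (an "inner product", not necessarily positive), and let $U$ be a strongly continuous unitary representation of the additive group $\mathbb R^d$ on a separable complex Hilbert space $\mathcal H$, with spectral resolution $E$, i.e. $E$ is the projection-valued measure on $\mathbb R^d$ with $U(x)=\int e^{ipx}\,dE(p)$ for all $x\in\mathbb R^d$. Let $\mathcal D\subset\mathcal H$ be the subspace of vectors $\Phi$ for which $x\mapsto U(x)\Phi$ is $C^\infty$, let $\alpha_x(F)=U(x)FU(x)^{-1}$, and let $|P|^2=\int |p|^2\,dE(p)$ be the sum of the squares of the generators. Let $\mathfrak F$ be the set of all linear operators $F$ in $\mathcal H$ whose domain contains $\mathcal D$ and for which there is $n\in\mathbb N$ such that the operators $(1+|P|^2)^{-n}\alpha_x(F)(1+|P|^2)^{-n}$ (on $\mathcal D$) extend to bounded operators on $\mathcal H$ which depend on $x\in\mathbb R^d$ infinitely differentiably in norm. For $h\in C_c^\infty(\mathbb R^d,\mathbb R)$ with $\int h=1$ and $\varepsilon>0$ put $h_\varepsilon(p)=\varepsilon^{-d}h(p/\varepsilon)$ and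 $E_{h,\varepsilon}(p)=\int h_\varepsilon(p-q)\,dE(q)$. For a function $A$ on $\mathbb R^d$ whose values are linear operators $\mathcal D\to\mathcal H$, the integrals $\int A(p)\,dE(p)$ and $\int dE(p)\,A(p)$ are defined on $\mathcal D$ in the sense of distributions, namely as the operators $$\Phi\mapsto\lim_{\varepsilon\downarrow 0}\int A(p)\,E_{h,\varepsilon}(p)\Phi\,dp ,\qquad \Phi\mapsto\lim_{\varepsilon\downarrow 0}\int E_{h,\varepsilon}(p)\,A(p)\Phi\,dp\qquad(\Phi\in\mathcal D),$$ provided that for every $h$ and $\Phi$ the integrands are integrable for every $\varepsilon>0$, the limits exist in norm, and they do not depend on $h$. Lemma 1. Let $F\in\mathfrak F$ and let $Q$ be a real $d\times d$ matrix that is skew-symmetric with respect to the given form, $q\,Qp=-p\,Qq$ for all $p,q\in\mathbb R^d$. Then both integrals $${}_QF=\int\alpha_{Qp}(F)\,dE(p),\qquad F_Q=\int dE(p)\,\alpha_{Qp}(F)$$ exist on $\mathcal D$, and ${}_QF=F_Q$. -/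

import Mathlib

open MeasureTheory Filter Topology
open scoped ContDiff InnerProductSpace

noncomputable section

namespace WarpedConvolution

variable {X : Type*} [MeasurableSpace X]
variable {H : Type*} [NormedAddCommGroup H] [InnerProductSpace ℂ H] [CompleteSpace H]

/-! ### Projection-valued measures -/

/-- A projection-valued measure on `X` acting on the Hilbert space `H`
(only the values on measurable sets matter). -/
structure ProjectionValuedMeasure (X : Type*) [MeasurableSpace X]
    (H : Type*) [NormedAddCommGroup H] [InnerProductSpace ℂ H] [CompleteSpace H] where
  /-- The projection attached to a set. -/
  proj : Set X → H →L[ℂ] H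
  isStarProjection : ∀ s, MeasurableSet s → IsStarProjection (proj s)
  proj_empty : proj ∅ = 0
  proj_univ : proj Set.univ = 1
  proj_inter : ∀ s t, MeasurableSet s → MeasurableSet t → proj (s ∩ t) = proj s * proj t
  hasSum_iUnion : ∀ s : ℕ → Set X, (∀ i, MeasurableSet (s i)) →
    Pairwise (Function.onFun Disjoint s) → ∀ v : H, HasSum (fun i => proj (s i) v) (proj (⋃ i, s i) v)

namespace ProjectionValuedMeasure

variable (E : ProjectionValuedMeasure X H)

lemma inner_proj {s : Set X} (hs : MeasurableSet s) (v w : H) :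
    ⟪E.proj s v, w⟫_ℂ = ⟪v, E.proj s w⟫_ℂ := by
  have h := (E.isStarProjection s hs).isSelfAdjoint
  rw [← ContinuousLinearMap.adjoint_inner_right]
  rw [← ContinuousLinearMap.star_eq_adjoint, h.star_eq]

lemma proj_proj {s : Set X} (hs : MeasurableSet s) (v : H) :
    E.proj s (E.proj s v) = E.proj s v := by
  have h := (E.isStarProjection s hs).isIdempotentElem
  exact congrArg (fun T : H →L[ℂ] H => T v) h

lemma norm_sq_proj {s : Set X} (hs : MeasurableSet s) (v : H) :
    ‖E.proj s v‖ ^ 2 = (⟪v, E.proj s v⟫_ℂ).re := by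
  rw [← E.proj_proj hs v, ← E.inner_proj hs, E.proj_proj hs]
  exact (inner_self_eq_norm_sq (𝕜 := ℂ) _).symm

/-- The finite measure `S ↦ ⟪v, E(S) v⟫ = ‖E(S) v‖²`. -/
def diag (v : H) : Measure X :=
  Measure.ofMeasurable (fun s _ => ENNReal.ofReal (‖E.proj s v‖ ^ 2))
    (by simp [E.proj_empty])
    (by
      intro f hf hd
      have h := E.hasSum_iUnion f hf hd v
      have h2 : HasSum (fun i => ‖E.proj (f i) v‖ ^ 2) (‖E.proj (⋃ i, f i) v‖ ^ 2) := by
        have h3 := (h.mapL (innerSL ℂ v)).mapL Complex.reCLM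
        simp only [innerSL_apply_apply, Complex.reCLM_apply] at h3
        rw [E.norm_sq_proj (MeasurableSet.iUnion hf)]
        exact h3.congr_fun fun i => E.norm_sq_proj (hf i) v
      rw [← h2.tsum_eq, ENNReal.ofReal_tsum_of_nonneg (fun _ => by positivity) h2.summable])

lemma diag_apply (v : H) {s : Set X} (hs : MeasurableSet s) :
    E.diag v s = ENNReal.ofReal (‖E.proj s v‖ ^ 2) :=
  Measure.ofMeasurable_apply s hs

instance (v : H) : IsFiniteMeasure (E.diag v) :=
  ⟨by rw [E.diag_apply v MeasurableSet.univ]; exact ENNReal.ofReal_lt_top⟩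

/-- `T = ∫ f(p) dE(p)` for a bounded operator `T`, i.e. `⟪v, T v⟫ = ∫ f(p) d⟪v, E(p) v⟫`
for all `v`. By polarization, this determines `T`. -/
def IsIntegral (f : X → ℂ) (T : H →L[ℂ] H) : Prop :=
  ∀ v : H, Integrable f (E.diag v) ∧ ⟪v, T v⟫_ℂ = ∫ p, f p ∂(E.diag v)

variable {E}

lemma IsIntegral.unique {f : X → ℂ} {S T : H →L[ℂ] H} (hS : E.IsIntegral f S)
    (hT : E.IsIntegral f T) : S = T := by
  refine ContinuousLinearMap.coe_injective ((ext_inner_map _ _).1 fun v => ?_)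
  have h := (hS v).2.trans (hT v).2.symm
  rw [← inner_conj_symm, ← inner_conj_symm _ v]
  exact congrArg _ h

variable (E)

open Classical in
/-- The bounded operator `∫ f(p) dE(p)`. It exists for every bounded measurable function `f`, see
`isIntegral_integral`. -/
def integral (f : X → ℂ) : H →L[ℂ] H :=
  if h : ∃ T, E.IsIntegral f T then h.choose else 0

variable {E}

lemma IsIntegral.integral_eq {f : X → ℂ} {T : H →L[ℂ] H} (hT : E.IsIntegral f T) :
    E.integral f = T := by
  have h : ∃ T, E.IsIntegral f T := ⟨T, hT⟩
  rw [integral, dif_pos h]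
  exact h.choose_spec.unique hT

variable (E)

/-- `∑ c, c E(g = c)` for a function `g` with finitely many values. -/
def simpleIntegral (g : SimpleFunc X ℂ) : H →L[ℂ] H :=
  ∑ c ∈ g.range, c • E.proj (g ⁻¹' {c})

lemma isIntegral_simpleIntegral (g : SimpleFunc X ℂ) : E.IsIntegral g (E.simpleIntegral g) := by
  intro v
  have hi : Integrable g (E.diag v) := SimpleFunc.integrable_of_isFiniteMeasure g
  refine ⟨hi, ?_⟩
  rw [← SimpleFunc.integral_eq_integral g hi, SimpleFunc.integral_eq]
  simp only [simpleIntegral, sum_apply, inner_sum,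
    smul_apply, inner_smul_right]
  refine Finset.sum_congr rfl fun c _ => ?_
  have hs : MeasurableSet (g ⁻¹' {c}) := g.measurableSet_fiber c
  rw [Measure.real, E.diag_apply v hs, ENNReal.toReal_ofReal (by positivity), Complex.real_smul,
    mul_comm, ← E.proj_proj hs v, ← E.inner_proj hs, E.proj_proj hs,
    inner_self_eq_norm_sq_to_K]
  simp

lemma IsIntegral.sub {f g : X → ℂ} {S T : H →L[ℂ] H} (hS : E.IsIntegral f S)
    (hT : E.IsIntegral g T) : E.IsIntegral (f - g) (S - T) := by
  intro v
  refine ⟨(hS v).1.sub (hT v).1, ?_⟩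
  simp only [sub_apply, inner_sub_right, Pi.sub_apply]
  rw [integral_sub (hS v).1 (hT v).1, (hS v).2, (hT v).2]

lemma diag_real_univ (v : H) : (E.diag v).real Set.univ = ‖v‖ ^ 2 := by
  rw [Measure.real, E.diag_apply v MeasurableSet.univ, ENNReal.toReal_ofReal (by positivity),
    E.proj_univ]
  rfl

lemma IsIntegral.norm_inner_le {f : X → ℂ} {T : H →L[ℂ] H} (hT : E.IsIntegral f T) {C : ℝ}
    (hf : ∀ p, ‖f p‖ ≤ C) (v : H) : ‖⟪v, T v⟫_ℂ‖ ≤ C * ‖v‖ ^ 2 := by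
  rw [(hT v).2, ← E.diag_real_univ v]
  exact norm_integral_le_of_norm_le_const (Eventually.of_forall hf)

lemma IsIntegral.norm_le {f : X → ℂ} {T : H →L[ℂ] H} (hT : E.IsIntegral f T) {C : ℝ}
    (hC : 0 ≤ C) (hf : ∀ p, ‖f p‖ ≤ C) : ‖T‖ ≤ 2 * C := by
  have key : ∀ v, ‖⟪(T : H →ₗ[ℂ] H) v, v⟫_ℂ‖ ≤ C * ‖v‖ ^ 2 := fun v => by
    rw [← inner_conj_symm, RCLike.norm_conj]
    exact IsIntegral.norm_inner_le E hT hf v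
  refine ContinuousLinearMap.opNorm_le_of_unit_norm (by positivity) fun x hx => ?_
  rcases eq_or_ne (T x) 0 with h0 | h0
  · rw [h0, norm_zero]; positivity
  have hn : ‖T x‖ ≠ 0 := norm_ne_zero_iff.2 h0
  set y : H := ((‖T x‖⁻¹ : ℝ) : ℂ) • T x with hy
  have hy1 : ‖y‖ = 1 := by
    rw [hy, norm_smul, Complex.norm_real, norm_inv, norm_norm, inv_mul_cancel₀ hn]
  have h1 : ‖T x‖ = ‖⟪(T : H →ₗ[ℂ] H) x, y⟫_ℂ‖ := by
    rw [hy, inner_smul_right, norm_mul, Complex.norm_real]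
    change _ = _ * ‖⟪T x, T x⟫_ℂ‖
    rw [inner_self_eq_norm_sq_to_K, norm_inv, norm_norm, norm_pow, RCLike.norm_ofReal, abs_norm]
    field_simp
  have hI : ‖Complex.I • y‖ = 1 := by rw [norm_smul, Complex.norm_I, one_mul, hy1]
  have p1 := parallelogram_law_with_norm ℂ x y
  have p2 := parallelogram_law_with_norm ℂ x (Complex.I • y)
  rw [hx, hy1] at p1
  rw [hx, hI] at p2
  rw [h1, inner_map_polarization' (T : H →ₗ[ℂ] H) x y, norm_div]
  have k1 := key (x + y)
  have k2 := key (x - y)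
  have k3 := key (x + Complex.I • y)
  have k4 := key (x - Complex.I • y)
  have t : ∀ a b c d : ℂ, ‖a - b - Complex.I * c + Complex.I * d‖ ≤ ‖a‖ + ‖b‖ + ‖c‖ + ‖d‖ := by
    intro a b c d
    refine (norm_add_le _ _).trans ?_
    have e1 := norm_sub_le (a - b) (Complex.I * c)
    have e2 := norm_sub_le a b
    rw [norm_mul, Complex.norm_I, one_mul] at e1
    rw [norm_mul, Complex.norm_I, one_mul]
    linarith
  have h4 : ‖(4 : ℂ)‖ = 4 := by simp
  rw [h4, div_le_iff₀ (by norm_num)]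
  refine (t _ _ _ _).trans ?_
  nlinarith

lemma exists_simpleFunc_close {f : X → ℂ} (hf : Measurable f) {C : ℝ} (hC : ∀ p, ‖f p‖ ≤ C)
    {δ : ℝ} (hδ : 0 < δ) : ∃ g : SimpleFunc X ℂ, ∀ p, ‖g p - f p‖ ≤ δ := by
  let e := TopologicalSpace.denseSeq ℂ
  have hcov : Metric.closedBall (0 : ℂ) C ⊆ ⋃ k, Metric.ball (e k) δ := fun z _ => by
    obtain ⟨k, hk⟩ := (TopologicalSpace.denseRange_denseSeq ℂ).exists_dist_lt z hδ
    exact Set.mem_iUnion.2 ⟨k, hk⟩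
  obtain ⟨t, ht⟩ := (isCompact_closedBall (0 : ℂ) C).elim_finite_subcover _
    (fun _ => Metric.isOpen_ball) hcov
  refine ⟨(SimpleFunc.nearestPt e (t.sup id)).comp f hf, fun p => ?_⟩
  have hp : f p ∈ Metric.closedBall (0 : ℂ) C := by simpa using hC p
  obtain ⟨k, hk, hk2⟩ := Set.mem_iUnion₂.1 (ht hp)
  have h := SimpleFunc.edist_nearestPt_le e (f p) (Finset.le_sup (f := id) hk)
  rw [edist_dist, edist_dist, ENNReal.ofReal_le_ofReal_iff dist_nonneg] at h
  rw [← dist_eq_norm]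
  refine h.trans ?_
  rw [dist_comm]
  exact (Metric.mem_ball.1 hk2).le

/-- Every bounded measurable function has an integral. -/
lemma isIntegral_integral {f : X → ℂ} (hf : Measurable f) {C : ℝ} (hC : ∀ p, ‖f p‖ ≤ C) :
    E.IsIntegral f (E.integral f) := by
  suffices h : ∃ T, E.IsIntegral f T by
    obtain ⟨T, hT⟩ := h
    rwa [hT.integral_eq]
  choose g hg using fun n : ℕ => exists_simpleFunc_close hf hC (Nat.one_div_pos_of_nat (α := ℝ) (n := n))
  have hlim := tendsto_one_div_add_atTop_nhds_zero_nat (𝕜 := ℝ)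
  have hcau : CauchySeq fun n => E.simpleIntegral (g n) := by
    refine cauchySeq_of_le_tendsto_0 (fun n : ℕ => 4 * (1 / ((n : ℝ) + 1))) (fun n m N hn hm => ?_)
      (by simpa using hlim.const_mul 4)
    have hmono : ∀ k, N ≤ k → 1 / ((k : ℝ) + 1) ≤ 1 / ((N : ℝ) + 1) := fun k hk =>
      Nat.one_div_le_one_div hk
    rw [dist_eq_norm]
    have := IsIntegral.norm_le E ((IsIntegral.sub E (E.isIntegral_simpleIntegral (g n))
      (E.isIntegral_simpleIntegral (g m)))) (C := 2 * (1 / ((N : ℝ) + 1))) (by positivity)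
      (fun p => by
        have e : (⇑(g n) - ⇑(g m)) p = (g n p - f p) - (g m p - f p) := by
          simp [Pi.sub_apply]
        rw [e]
        refine (norm_sub_le _ _).trans ?_
        linarith [hg n p, hg m p, hmono n hn, hmono m hm])
    linarith
  obtain ⟨T, hT⟩ := cauchySeq_tendsto_of_complete hcau
  refine ⟨T, fun v => ?_⟩
  have hint : Integrable f (E.diag v) :=
    Integrable.of_bound hf.aestronglyMeasurable C (Eventually.of_forall hC)
  refine ⟨hint, ?_⟩
  have h1 : Tendsto (fun n => ⟪v, E.simpleIntegral (g n) v⟫_ℂ) atTop (𝓝 ⟪v, T v⟫_ℂ) :=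
    tendsto_const_nhds.inner ((ContinuousLinearMap.apply ℂ H v).continuous.tendsto T |>.comp hT)
  refine tendsto_nhds_unique h1 ?_
  simp_rw [(E.isIntegral_simpleIntegral _ v).2]
  refine tendsto_integral_of_dominated_convergence (fun _ => C + 1)
    (fun n => (g n).measurable.aestronglyMeasurable) (integrable_const _)
    (fun n => Eventually.of_forall fun p => ?_) (Eventually.of_forall fun p => ?_)
  · have h2 : g n p = (g n p - f p) + f p := by ring
    have h3 : 1 / ((n : ℝ) + 1) ≤ 1 := by
      rw [div_le_one (by positivity)]; linarith [n.cast_nonneg (α := ℝ)]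
    rw [h2]
    linarith [norm_add_le (g n p - f p) (f p), hg n p, hC p]
  · exact tendsto_iff_norm_sub_tendsto_zero.2
      (squeeze_zero (fun _ => norm_nonneg _) (fun n => hg n p) hlim)

lemma proj_comm {s t : Set X} (hs : MeasurableSet s) (ht : MeasurableSet t) (v : H) :
    E.proj s (E.proj t v) = E.proj t (E.proj s v) := by
  have h : E.proj s * E.proj t = E.proj t * E.proj s := by
    rw [← E.proj_inter s t hs ht, ← E.proj_inter t s ht hs, Set.inter_comm]
  exact congrArg (fun T : H →L[ℂ] H => T v) h

/-- An integral commutes with the unitaries that commute with the projections. -/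
lemma IsIntegral.comm_unitary {f : X → ℂ} {T V W : H →L[ℂ] H} (hT : E.IsIntegral f T)
    (hVW : ∀ v w, ⟪V v, w⟫_ℂ = ⟪v, W w⟫_ℂ) (h1 : ∀ v, W (V v) = v) (h2 : ∀ v, V (W v) = v)
    (hV : ∀ s, MeasurableSet s → ∀ v, E.proj s (V v) = V (E.proj s v)) (v : H) :
    T (V v) = V (T v) := by
  have hnorm : ∀ w, ‖V w‖ = ‖w‖ := fun w => by
    rw [@norm_eq_sqrt_re_inner ℂ _ _ _ _ (V w), @norm_eq_sqrt_re_inner ℂ _ _ _ _ w, hVW, h1]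
  have hd : ∀ w, E.diag (V w) = E.diag w := fun w => Measure.ext fun s hs => by
    rw [E.diag_apply _ hs, E.diag_apply _ hs, hV s hs, hnorm]
  have hS : E.IsIntegral f (W.comp (T.comp V)) := fun w => by
    have h := hT (V w)
    rw [hd, hVW] at h
    exact h
  have h := congrArg (fun S : H →L[ℂ] H => V (S v)) (hS.unique hT)
  simpa [h2] using h

lemma IsIntegral.comm_proj {f : X → ℂ} {T : H →L[ℂ] H} (hT : E.IsIntegral f T)
    {s : Set X} (hs : MeasurableSet s) (v : H) : T (E.proj s v) = E.proj s (T v) := by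
  let R : H →L[ℂ] H := (2 : ℂ) • E.proj s - 1
  have hR : ∀ w, R w = (2 : ℂ) • E.proj s w - w := fun w => rfl
  have hRR : ∀ w, R (R w) = w := fun w => by
    simp only [hR, map_sub, map_smul, E.proj_proj hs]
    module
  have h := IsIntegral.comm_unitary E hT (V := R) (W := R)
    (fun v w => by
      simp only [hR, inner_sub_left, inner_sub_right, inner_smul_left, inner_smul_right,
        E.inner_proj hs, Complex.conj_ofNat]) hRR hRR
    (fun t ht w => by simp only [hR, map_sub, map_smul, E.proj_comm ht hs]) v
  simp only [hR, map_sub, map_smul, sub_left_inj] at h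
  exact smul_right_injective H (two_ne_zero' ℂ) h

end ProjectionValuedMeasure

/-! ### Translations, their spectral resolution, and smooth vectors -/

/-- A strongly continuous unitary representation of the additive group `ℝ^d` on `H`. -/
structure TranslationRep (d : ℕ) (H : Type*) [NormedAddCommGroup H] [InnerProductSpace ℂ H] where
  /-- The unitary operator `U(x)`. -/
  toFun : EuclideanSpace ℝ (Fin d) → H ≃ₗᵢ[ℂ] H
  map_add : ∀ x y v, toFun (x + y) v = toFun x (toFun y v)
  continuous : ∀ v, Continuous fun x => toFun x v

variable {d : ℕ}

instance : CoeFun (TranslationRep d H) fun _ => EuclideanSpace ℝ (Fin d) → H ≃ₗᵢ[ℂ] H :=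
  ⟨TranslationRep.toFun⟩

/-- The subspace `𝒟` of smooth vectors: those `v` for which `x ↦ U(x) v` is of class `C^∞`. -/
def TranslationRep.smoothVectors (U : TranslationRep d H) : Submodule ℂ H where
  carrier := {v | ContDiff ℝ ∞ fun x => U x v}
  add_mem' := fun {v w} hv hw => by
    rw [Set.mem_ofPred_eq] at hv hw ⊢
    simpa only [_root_.map_add] using hv.add hw
  zero_mem' := by
    rw [Set.mem_ofPred_eq]
    simpa only [map_zero] using contDiff_const
  smul_mem' := fun c v hv => by
    rw [Set.mem_ofPred_eq] at hv ⊢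
    simpa only [map_smul] using hv.const_smul c

lemma TranslationRep.mem_smoothVectors (U : TranslationRep d H) (v : H) :
    v ∈ U.smoothVectors ↔ ContDiff ℝ ∞ fun x => U x v := Iff.rfl

lemma TranslationRep.apply_mem_smoothVectors (U : TranslationRep d H) (x : EuclideanSpace ℝ (Fin d))
    {v : H} (hv : v ∈ U.smoothVectors) : U x v ∈ U.smoothVectors := by
  rw [U.mem_smoothVectors] at hv ⊢
  have h : ContDiff ℝ ∞ fun y => U (y + x) v := hv.comp (contDiff_id.add contDiff_const)
  simpa only [U.map_add] using h

/-- `U(x)` as a map of `𝒟` to itself. -/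
def TranslationRep.onSmooth (U : TranslationRep d H) (x : EuclideanSpace ℝ (Fin d)) :
    U.smoothVectors →ₗ[ℂ] U.smoothVectors :=
  (U x).toLinearEquiv.toLinearMap.restrict fun _ hv => U.apply_mem_smoothVectors x hv

/-- The adjoint action `α_x(F) = U(x) F U(x)⁻¹` on operators `F : 𝒟 → H`. -/
def TranslationRep.adjointAction (U : TranslationRep d H) (x : EuclideanSpace ℝ (Fin d))
    (F : U.smoothVectors →ₗ[ℂ] H) : U.smoothVectors →ₗ[ℂ] H :=
  (U x).toLinearEquiv.toLinearMap ∘ₗ F ∘ₗ U.onSmooth (-x)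

/-- The spectral resolution of `U` with respect to the inner product `B` on `ℝ^d`: a
projection-valued measure `E` on `ℝ^d` with `U(x) = ∫ exp(i B(p, x)) dE(p)` for all `x`. -/
structure SpectralResolution (B : LinearMap.BilinForm ℝ (EuclideanSpace ℝ (Fin d)))
    (U : TranslationRep d H) extends ProjectionValuedMeasure (EuclideanSpace ℝ (Fin d)) H where
  isIntegral : ∀ x, toProjectionValuedMeasure.IsIntegral
    (fun p => Complex.exp (Complex.I * (B p x : ℂ))) ((U x).toContinuousLinearEquiv : H →L[ℂ] H)

namespace SpectralResolution

variable {B : LinearMap.BilinForm ℝ (EuclideanSpace ℝ (Fin d))} {U : TranslationRep d H}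
  (E : SpectralResolution B U)

lemma integral_comm (f : EuclideanSpace ℝ (Fin d) → ℂ) (x : EuclideanSpace ℝ (Fin d)) (v : H) :
    U x (E.integral f v) = E.integral f (U x v) := by
  by_cases h : ∃ T, E.IsIntegral f T
  · obtain ⟨T, hT⟩ := h
    rw [hT.integral_eq]
    refine (ProjectionValuedMeasure.IsIntegral.comm_unitary _ hT
      (V := ((U x).toContinuousLinearEquiv : H →L[ℂ] H))
      (W := ((U x).symm.toContinuousLinearEquiv : H →L[ℂ] H))
      (fun v w => (U x).inner_map_eq_flip v w) (fun v => (U x).symm_apply_apply v)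
      (fun v => (U x).apply_symm_apply v) (fun s hs v => ?_) v).symm
    exact (ProjectionValuedMeasure.IsIntegral.comm_proj _ (E.isIntegral x) hs v).symm
  · rw [ProjectionValuedMeasure.integral, dif_neg h]
    simp

lemma integral_mem_smoothVectors (f : EuclideanSpace ℝ (Fin d) → ℂ) {v : H}
    (hv : v ∈ U.smoothVectors) : E.integral f v ∈ U.smoothVectors := by
  rw [U.mem_smoothVectors] at hv ⊢
  simp only [E.integral_comm]
  exact ((E.integral f).restrictScalars ℝ).contDiff.comp hv

/-- The operator `∫ f(p) dE(p)` as a map of `𝒟` to itself. -/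
def onSmooth (f : EuclideanSpace ℝ (Fin d) → ℂ) : U.smoothVectors →ₗ[ℂ] U.smoothVectors :=
  (E.integral f).toLinearMap.restrict fun _ hv => E.integral_mem_smoothVectors f hv

end SpectralResolution

/-! ### Translation-smooth operators -/

/-- The function `p ↦ (1 + |p|²)⁻ⁿ`; its integral with respect to `E` is `(1 + |P|²)⁻ⁿ`, where
`|P|²` is the sum of the squares of the components of the generators `P = ∫ p dE(p)`. -/
def damping (d n : ℕ) (p : EuclideanSpace ℝ (Fin d)) : ℂ :=
  (((1 + ‖p‖ ^ 2) ^ n)⁻¹ : ℝ)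

/-- The restriction to `𝒟` of an operator that has `𝒟` in its domain. -/
def restrictSmooth (U : TranslationRep d H) (F : H →ₗ.[ℂ] H) (hF : U.smoothVectors ≤ F.domain) :
    U.smoothVectors →ₗ[ℂ] H :=
  F.toFun ∘ₗ Submodule.inclusion hF

/-- The set `𝔉` of translation-smooth operators: `F` has `𝒟` in its domain and, for some `n`, the
operators `(1 + |P|²)⁻ⁿ α_x(F) (1 + |P|²)⁻ⁿ` on `𝒟` extend to bounded operators on `H` which depend
on `x` in a norm-smooth manner. -/
structure IsTranslationSmooth {B : LinearMap.BilinForm ℝ (EuclideanSpace ℝ (Fin d))}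
    {U : TranslationRep d H} (E : SpectralResolution B U) (F : H →ₗ.[ℂ] H) : Prop where
  le_domain : U.smoothVectors ≤ F.domain
  exists_smooth : ∃ n : ℕ, ∃ T : EuclideanSpace ℝ (Fin d) → H →L[ℂ] H, ContDiff ℝ ∞ T ∧
    ∀ x, ∀ v : U.smoothVectors, T x v =
      E.integral (damping d n)
        (U.adjointAction x (restrictSmooth U F le_domain) (E.onSmooth (damping d n) v))

/-! ### Integrals of operator-valued functions against `dE`, in the sense of distributions

The operator-valued distribution `dE` is replaced by its regularizations
`(h_ε * dE)(p) dp = (∫ h_ε(p - q) dE(q)) dp`, where `h_ε(p) = ε⁻ᵈ h(p / ε)` and `h` is a test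
function with `∫ h = 1`, and then `ε` tends to `0`. The limit has to exist on every vector in `𝒟`
and to be the same for every `h`. -/

/-- A test function on `ℝ^d` of total integral `1`. -/
structure IsMollifier (h : EuclideanSpace ℝ (Fin d) → ℝ) : Prop where
  contDiff : ContDiff ℝ ∞ h
  hasCompactSupport : HasCompactSupport h
  integral_eq_one : ∫ p, h p = 1

/-- The function `q ↦ h_ε(p - q) = ε⁻ᵈ h((p - q) / ε)`. -/
def mollify (h : EuclideanSpace ℝ (Fin d) → ℝ) (ε : ℝ) (p q : EuclideanSpace ℝ (Fin d)) : ℂ :=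
  ((ε ^ d)⁻¹ * h (ε⁻¹ • (p - q)) : ℝ)

section Integrals

variable {B : LinearMap.BilinForm ℝ (EuclideanSpace ℝ (Fin d))} {U : TranslationRep d H}
  (E : SpectralResolution B U) (A : EuclideanSpace ℝ (Fin d) → U.smoothVectors →ₗ[ℂ] H)

/-- `∫ A(p) dE(p) = G` on `𝒟`. -/
def HasLeftIntegral (G : U.smoothVectors →ₗ[ℂ] H) : Prop :=
  ∀ h : EuclideanSpace ℝ (Fin d) → ℝ, IsMollifier h → ∀ v : U.smoothVectors,
    (∀ ε > 0, Integrable fun p => A p (E.onSmooth (mollify h ε p) v)) ∧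
    Tendsto (fun ε => ∫ p, A p (E.onSmooth (mollify h ε p) v)) (𝓝[>] 0) (𝓝 (G v))

/-- `∫ dE(p) A(p) = G` on `𝒟`. -/
def HasRightIntegral (G : U.smoothVectors →ₗ[ℂ] H) : Prop :=
  ∀ h : EuclideanSpace ℝ (Fin d) → ℝ, IsMollifier h → ∀ v : U.smoothVectors,
    (∀ ε > 0, Integrable fun p => E.integral (mollify h ε p) (A p v)) ∧
    Tendsto (fun ε => ∫ p, E.integral (mollify h ε p) (A p v)) (𝓝[>] 0) (𝓝 (G v))

lemma exists_isMollifier (d : ℕ) : ∃ h : EuclideanSpace ℝ (Fin d) → ℝ, IsMollifier h := by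
  let b : ContDiffBump (0 : EuclideanSpace ℝ (Fin d)) := default
  exact ⟨b.normed volume, b.contDiff_normed, b.hasCompactSupport_normed, b.integral_normed⟩

variable {E A}

/-- The left integral is determined by the integrand. -/
lemma HasLeftIntegral.unique {G G' : U.smoothVectors →ₗ[ℂ] H} (hG : HasLeftIntegral E A G)
    (hG' : HasLeftIntegral E A G') : G = G' := by
  obtain ⟨h, hh⟩ := exists_isMollifier d
  exact LinearMap.ext fun v => tendsto_nhds_unique (hG h hh v).2 (hG' h hh v).2

/-- The right integral is determined by the integrand. -/
lemma HasRightIntegral.unique {G G' : U.smoothVectors →ₗ[ℂ] H} (hG : HasRightIntegral E A G)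
    (hG' : HasRightIntegral E A G') : G = G' := by
  obtain ⟨h, hh⟩ := exists_isMollifier d
  exact LinearMap.ext fun v => tendsto_nhds_unique (hG h hh v).2 (hG' h hh v).2

end Integrals

/-- The operator-valued function `p ↦ α_{Qp}(F)` on `𝒟`. -/
def warpedIntegrand (U : TranslationRep d H) (Q : Matrix (Fin d) (Fin d) ℝ) (F : H →ₗ.[ℂ] H)
    (hF : U.smoothVectors ≤ F.domain) (p : EuclideanSpace ℝ (Fin d)) :
    U.smoothVectors →ₗ[ℂ] H :=
  U.adjointAction (Matrix.toEuclideanLin Q p) (restrictSmooth U F hF)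

end WarpedConvolution

end

/-!
The proof rests on a formal computation with "matrix elements" `F(k, q)` of `F` between the spectral
values `k` and `q` of the generators. As `α_x(F)(k, q) = exp(i (k - q) x) F(k, q)`, the regularized
left and right integrals have the matrix elements
`∫ dp h_ε(p - q) exp(i (k - q) Qp) F(k, q)` and `∫ dp h_ε(p - k) exp(i (k - q) Qp) F(k, q)`,
which are translates of each other since `(k - q) Q(k - q) = 0`. Hence the two regularized integrals
are equal for every `ε`, and only the left one needs a limit.

*Reduction to bounded operators.* Let `r` be the spectral integral of `∏ⱼ (1 + i pⱼ)⁻¹`, a product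
of resolvents of generators. A vector is smooth only if it is of the form `r w` with a smooth `w`, and
a bounded operator `T` that is smooth under translations satisfies `T r = r T'` with another such
`T'`, because the commutators of `T` with the generators are derivatives of `x ↦ α_x(T)`
(`SpectralResolution.isRegularizer_resolventProd`). Therefore `F rᴺ` is the restriction of a smooth
bounded operator `S` for large `N` (`SpectralResolution.exists_isSmoothOp_eq`), and `F` can be
replaced by `S`. The same facts provide the decay in `p` that makes both integrands integrable.

*Equality.* The computation above is literally true when the spectral measure is concentrated on
finitely many points. The general case follows by composing all the spectral functions with simple
functions that converge pointwise to the identity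
(`ProjectionValuedMeasure.IsSymbolPair.integral_eq_of_kernel_eq`,
`SpectralResolution.integral_left_eq_right`).

*Convergence.* All derivatives of `p ↦ α_{Qp}(S)` are bounded, so this function is
`(1 + |p|²)ᴷ ∫ exp(2πi ⟨x, p⟩) g(x) dx` with an integrable operator-valued `g`
(`exists_fourier_representation`). For a single mode `x`, the regularized integral is the spectral
integral of the scalar function `∫ dp h_ε(p - q) (1 + |p|²)ᴷ exp(2πi ⟨x, p⟩)` of `q`, which after
damping is bounded uniformly in `x` and `ε ≤ 1` and converges to its value at `p = q`. Dominated
convergence in `x` gives the limit, in which `h` no longer appears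
(`SpectralResolution.exists_tendsto_left`).
-/

noncomputable section

namespace WarpedConvolution

/-! ### Functional calculus of a projection-valued measure -/

namespace ProjectionValuedMeasure

variable {X : Type*} [MeasurableSpace X]
  {H : Type*} [NormedAddCommGroup H] [InnerProductSpace ℂ H] [CompleteSpace H]
  {E : ProjectionValuedMeasure X H}

lemma IsIntegral.const_smul {f : X → ℂ} {T : H →L[ℂ] H} (hT : E.IsIntegral f T) (c : ℂ) :
    E.IsIntegral (fun p => c * f p) (c • T) := fun v => by
  refine ⟨(hT v).1.const_mul c, ?_⟩
  rw [smul_apply, inner_smul_right, (hT v).2, integral_const_mul]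

lemma IsIntegral.sum {ι : Type*} (s : Finset ι) {f : ι → X → ℂ} {T : ι → H →L[ℂ] H}
    (hT : ∀ i ∈ s, E.IsIntegral (f i) (T i)) :
    E.IsIntegral (fun p => ∑ i ∈ s, f i p) (∑ i ∈ s, T i) := fun v => by
  refine ⟨integrable_finsetSum _ fun i hi => (hT i hi v).1, ?_⟩
  rw [sum_apply, inner_sum, integral_finsetSum _ fun i hi => (hT i hi v).1]
  exact Finset.sum_congr rfl fun i hi => (hT i hi v).2

lemma isIntegral_one : E.IsIntegral (fun _ => 1) (ContinuousLinearMap.id ℂ H) := fun v => by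
  refine ⟨integrable_const _, ?_⟩
  change ⟪v, v⟫_ℂ = _
  rw [integral_const, E.diag_real_univ, inner_self_eq_norm_sq_to_K]
  simp

lemma IsIntegral.adjoint {f : X → ℂ} {T : H →L[ℂ] H} (hT : E.IsIntegral f T) :
    E.IsIntegral (fun p => starRingEnd ℂ (f p)) (ContinuousLinearMap.adjoint T) := fun v => by
  refine ⟨(LinearIsometryEquiv.integrable_comp_iff Complex.conjLIE).2 (hT v).1, ?_⟩
  rw [ContinuousLinearMap.adjoint_inner_right, ← inner_conj_symm, (hT v).2, integral_conj]

lemma diag_proj {s : Set X} (hs : MeasurableSet s) (v : H) :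
    E.diag (E.proj s v) = (E.diag v).restrict s := Measure.ext fun t ht => by
  rw [Measure.restrict_apply ht, E.diag_apply _ ht, E.diag_apply _ (ht.inter hs),
    E.proj_inter t s ht hs, mul_apply_eq_comp]

/-- Cutting an integrand off outside `s` multiplies its integral by the projection of `s`. -/
lemma IsIntegral.indicator {f : X → ℂ} {T : H →L[ℂ] H} (hT : E.IsIntegral f T)
    {s : Set X} (hs : MeasurableSet s) : E.IsIntegral (s.indicator f) (T * E.proj s) := fun v => by
  have h := hT (E.proj s v)
  rw [diag_proj hs] at h
  refine ⟨(integrable_indicator_iff hs).2 h.1, ?_⟩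
  rw [MeasureTheory.integral_indicator hs, ← h.2, mul_apply_eq_comp,
    E.inner_proj hs, ← IsIntegral.comm_proj E hT hs, E.proj_proj hs]

/-- Composition with a function `s` with finitely many values turns the spectral integral into a
finite sum. -/
lemma IsIntegral.comp_simpleFunc {Y : Type*} (g : Y → ℂ) (s : SimpleFunc X Y) :
    E.IsIntegral (fun p => g (s p)) (∑ c ∈ s.range, g c • E.proj (s ⁻¹' {c})) := by
  have h := IsIntegral.sum (E := E) s.range
    (f := fun c p => g c * (s ⁻¹' {c}).indicator (fun _ => 1) p)
    (T := fun c => g c • E.proj (s ⁻¹' {c})) fun c _ => by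
      exact (isIntegral_one.indicator (s.measurableSet_fiber c)).const_smul (g c)
  convert h using 2 with p
  rw [Finset.sum_eq_single (s p)]
  · simp
  · intro c _ hc
    simp [Set.indicator, Ne.symm hc]
  · intro hp
    exact absurd (s.mem_range_self p) hp

/-- Multiplicativity of the spectral integral when one factor has finitely many values. -/
lemma IsIntegral.mul_simpleFunc {f : X → ℂ} {T : H →L[ℂ] H} (hT : E.IsIntegral f T)
    (g : SimpleFunc X ℂ) : E.IsIntegral (fun p => f p * g p) (T * E.simpleIntegral g) := by
  have h := IsIntegral.sum (E := E) g.range (f := fun c p => c * (g ⁻¹' {c}).indicator f p)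
    (T := fun c => c • (T * E.proj (g ⁻¹' {c}))) fun c _ =>
      (hT.indicator (g.measurableSet_fiber c)).const_smul c
  rw [simpleIntegral, Finset.mul_sum]
  simp only [mul_smul_comm]
  convert h using 2 with p
  rw [Finset.sum_eq_single (g p)]
  · simp [mul_comm]
  · intro c _ hc
    simp [Set.indicator, Ne.symm hc]
  · intro hp
    exact absurd (g.mem_range_self p) hp

/-- The spectral integral is multiplicative. -/
lemma IsIntegral.mul {f g : X → ℂ} {S T : H →L[ℂ] H} (hS : E.IsIntegral f S)
    (hT : E.IsIntegral g T) (hg : Measurable g) {C : ℝ} (hC : ∀ p, ‖g p‖ ≤ C) :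
    E.IsIntegral (fun p => f p * g p) (S * T) := by
  choose s hs using fun n : ℕ =>
    exists_simpleFunc_close hg hC (Nat.one_div_pos_of_nat (α := ℝ) (n := n))
  have hlim := tendsto_one_div_add_atTop_nhds_zero_nat (𝕜 := ℝ)
  have h1 : Tendsto (fun n => E.simpleIntegral (s n)) atTop (𝓝 T) := by
    rw [tendsto_iff_norm_sub_tendsto_zero]
    refine squeeze_zero (fun _ => norm_nonneg _) (fun n => ?_)
      (by simpa only [mul_zero] using hlim.const_mul 2)
    exact IsIntegral.norm_le E (IsIntegral.sub E (E.isIntegral_simpleIntegral (s n)) hT)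
      (by positivity) (hs n)
  intro v
  have hint : Integrable (fun p => f p * g p) (E.diag v) :=
    (hS v).1.mul_bdd (c := C) hg.aestronglyMeasurable (Eventually.of_forall hC)
  refine ⟨hint, ?_⟩
  have h2 : Tendsto (fun n => ⟪v, (S * E.simpleIntegral (s n)) v⟫_ℂ) atTop (𝓝 ⟪v, (S * T) v⟫_ℂ) :=
    tendsto_const_nhds.inner
      ((ContinuousLinearMap.apply ℂ H v).continuous.tendsto _ |>.comp (h1.const_mul S))
  refine tendsto_nhds_unique h2 ?_
  simp_rw [(hS.mul_simpleFunc (s _) v).2]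
  refine tendsto_integral_of_dominated_convergence (fun p => ‖f p‖ * (C + 1))
    (fun n => (hS v).1.aestronglyMeasurable.mul (s n).measurable.aestronglyMeasurable)
    ((hS v).1.norm.mul_const _)
    (fun n => Eventually.of_forall fun p => ?_) (Eventually.of_forall fun p => ?_)
  · rw [norm_mul]
    gcongr
    have h3 : 1 / ((n : ℝ) + 1) ≤ 1 := by
      rw [div_le_one (by positivity)]; linarith [n.cast_nonneg (α := ℝ)]
    have h4 : s n p = (s n p - g p) + g p := by ring
    rw [h4]
    linarith [norm_add_le (s n p - g p) (g p), hs n p, hC p]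
  · refine Tendsto.const_mul _ ?_
    exact tendsto_iff_norm_sub_tendsto_zero.2
      (squeeze_zero (fun _ => norm_nonneg _) (fun n => hs n p) hlim)

lemma integral_mul {f g : X → ℂ} (hf : Measurable f) {C : ℝ} (hC : ∀ p, ‖f p‖ ≤ C)
    (hg : Measurable g) {C' : ℝ} (hC' : ∀ p, ‖g p‖ ≤ C') :
    E.integral (fun p => f p * g p) = E.integral f * E.integral g :=
  ((E.isIntegral_integral hf hC).mul (E.isIntegral_integral hg hC') hg hC').integral_eq

lemma integral_sub_eq {f g : X → ℂ} (hf : Measurable f) {C : ℝ} (hC : ∀ p, ‖f p‖ ≤ C)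
    (hg : Measurable g) {C' : ℝ} (hC' : ∀ p, ‖g p‖ ≤ C') :
    E.integral (fun p => f p - g p) = E.integral f - E.integral g :=
  (IsIntegral.sub E (E.isIntegral_integral hf hC) (E.isIntegral_integral hg hC')).integral_eq

lemma integral_const_mul_eq {f : X → ℂ} (hf : Measurable f) {C : ℝ} (hC : ∀ p, ‖f p‖ ≤ C)
    (c : ℂ) : E.integral (fun p => c * f p) = c • E.integral f :=
  ((E.isIntegral_integral hf hC).const_smul c).integral_eq

/-- `‖(∫ f dE) v‖² = ∫ |f|² d⟪v, E v⟫`. -/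
lemma norm_sq_integral_apply {f : X → ℂ} (hf : Measurable f) {C : ℝ} (hC : ∀ p, ‖f p‖ ≤ C)
    (v : H) : ‖E.integral f v‖ ^ 2 = ∫ p, ‖f p‖ ^ 2 ∂(E.diag v) := by
  have hT := E.isIntegral_integral hf hC
  have h := (hT.adjoint.mul hT hf hC v).2
  rw [mul_apply_eq_comp, ContinuousLinearMap.adjoint_inner_right,
    inner_self_eq_norm_sq_to_K] at h
  simp_rw [Complex.conj_mul'] at h
  norm_cast at h
  exact Complex.ofReal_injective h

lemma norm_integral_apply_le {f : X → ℂ} (hf : Measurable f) {C : ℝ} (hC0 : 0 ≤ C)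
    (hC : ∀ p, ‖f p‖ ≤ C) (v : H) : ‖E.integral f v‖ ≤ C * ‖v‖ := by
  refine le_of_sq_le_sq ?_ (by positivity)
  rw [norm_sq_integral_apply hf hC, mul_pow, ← E.diag_real_univ v]
  refine (Real.le_norm_self _).trans
    (norm_integral_le_of_norm_le_const (Eventually.of_forall fun p => ?_))
  rw [norm_pow, norm_norm]
  exact pow_le_pow_left₀ (norm_nonneg _) (hC p) 2

lemma norm_integral_le {f : X → ℂ} (hf : Measurable f) {C : ℝ} (hC0 : 0 ≤ C)
    (hC : ∀ p, ‖f p‖ ≤ C) : ‖E.integral f‖ ≤ C :=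
  ContinuousLinearMap.opNorm_le_bound _ hC0 (norm_integral_apply_le hf hC0 hC)

/-- Bounded pointwise convergence of functions implies strong convergence of their integrals. -/
lemma tendsto_integral_apply_of_eventually {ι : Type*} {l : Filter ι} [l.IsCountablyGenerated]
    {f : ι → X → ℂ} {g : X → ℂ} (hf : ∀ᶠ i in l, Measurable (f i)) (hg : Measurable g)
    {C : ℝ} (hC : ∀ᶠ i in l, ∀ p, ‖f i p‖ ≤ C) (hgC : ∀ p, ‖g p‖ ≤ C)
    (h : ∀ p, Tendsto (fun i => f i p) l (𝓝 (g p))) (v : H) :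
    Tendsto (fun i => E.integral (f i) v) l (𝓝 (E.integral g v)) := by
  rw [tendsto_iff_norm_sub_tendsto_zero]
  have hb : ∀ᶠ i in l, ∀ p, ‖f i p - g p‖ ≤ C + C := hC.mono fun i hi p =>
    (norm_sub_le _ _).trans (add_le_add (hi p) (hgC p))
  have h1 : ∀ᶠ i in l, √(∫ p, ‖f i p - g p‖ ^ 2 ∂(E.diag v)) =
      ‖E.integral (f i) v - E.integral g v‖ := by
    filter_upwards [hf, hC, hb] with i hfi hCi hbi
    rw [← norm_sq_integral_apply (f := fun p => f i p - g p) (hfi.sub hg) hbi,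
      Real.sqrt_sq (norm_nonneg _), integral_sub_eq hfi hCi hg hgC, sub_apply]
  refine Tendsto.congr' h1 ?_
  rw [← Real.sqrt_zero]
  refine (Real.continuous_sqrt.tendsto 0).comp ?_
  have h2 : ∫ _, (0 : ℝ) ∂(E.diag v) = 0 := by simp
  rw [← h2]
  refine tendsto_integral_filter_of_dominated_convergence (fun _ => (C + C) ^ 2)
    (hf.mono fun i hi => ((hi.sub hg).norm.pow_const 2).aestronglyMeasurable)
    (hb.mono fun i hi => Eventually.of_forall fun p => ?_) (integrable_const _)
    (Eventually.of_forall fun p => ?_)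
  · rw [norm_pow, norm_norm]
    exact pow_le_pow_left₀ (norm_nonneg _) (hi p) 2
  · simpa using ((tendsto_iff_norm_sub_tendsto_zero.1 (h p)).pow 2)

lemma tendsto_integral_apply {ι : Type*} {l : Filter ι} [l.IsCountablyGenerated]
    {f : ι → X → ℂ} {g : X → ℂ} (hf : ∀ i, Measurable (f i)) (hg : Measurable g)
    {C : ℝ} (hC : ∀ i p, ‖f i p‖ ≤ C) (hgC : ∀ p, ‖g p‖ ≤ C)
    (h : ∀ p, Tendsto (fun i => f i p) l (𝓝 (g p))) (v : H) :
    Tendsto (fun i => E.integral (f i) v) l (𝓝 (E.integral g v)) :=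
  tendsto_integral_apply_of_eventually (Eventually.of_forall hf) hg (Eventually.of_forall hC)
    hgC h v

/-- The spectral integral of a function without zeros is injective. -/
lemma integral_injective {f : X → ℂ} (hf : Measurable f) {C : ℝ} (hC : ∀ p, ‖f p‖ ≤ C)
    (h0 : ∀ p, f p ≠ 0) : Function.Injective (E.integral f) := by
  rw [injective_iff_map_eq_zero]
  intro v hv
  have h := norm_sq_integral_apply (E := E) hf hC v
  rw [hv, norm_zero, zero_pow two_ne_zero, eq_comm, integral_eq_zero_iff_of_nonneg
    (fun p => by positivity)] at h
  · have h2 : E.diag v = 0 := by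
      rw [← ae_eq_bot, ← Filter.empty_mem_iff_bot]
      filter_upwards [h] with p hp
      simp [h0 p] at hp
    have h3 := E.diag_real_univ v
    rw [h2] at h3
    simpa using h3.symm
  · refine Integrable.of_bound (hf.norm.pow_const 2).aestronglyMeasurable (C ^ 2)
      (Eventually.of_forall fun p => ?_)
    rw [norm_pow, norm_norm]
    exact pow_le_pow_left₀ (norm_nonneg _) (hC p) 2

/-- Fubini's theorem: the integral of spectral integrals with respect to a parameter `y` is the
spectral integral of the parameter integral. Testing on the diagonal `⟪v, · v⟫` reduces this to the
scalar theorem. -/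
lemma isIntegral_integral_param {Y : Type*} [MeasurableSpace Y] {μ : Measure Y} [SFinite μ]
    {g : Y → X → ℂ} (hg : Measurable (Function.uncurry g)) {c : Y → ℝ} (hc : Integrable c μ)
    (hgc : ∀ y p, ‖g y p‖ ≤ c y) (hE : AEStronglyMeasurable (fun y => E.integral (g y)) μ) :
    E.IsIntegral (fun p => ∫ y, g y p ∂μ) (∫ y, E.integral (g y) ∂μ) := fun v => by
  have hm : ∀ y, Measurable (g y) := fun y => hg.comp measurable_prodMk_left
  by_cases hX : Nonempty X
  swap
  · have : IsEmpty X := not_nonempty_iff.1 hX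
    have hv : v = 0 := by
      have h3 := E.diag_real_univ v
      rw [Set.univ_eq_empty_iff.2 this] at h3
      simpa using h3.symm
    subst hv
    refine ⟨Integrable.of_bound (measurable_of_empty _).aestronglyMeasurable 0
      (Eventually.of_forall fun p => this.elim p), ?_⟩
    rw [inner_zero_left, integral_of_isEmpty]
  obtain ⟨x0⟩ := hX
  have hc0 : ∀ y, 0 ≤ c y := fun y => (norm_nonneg _).trans (hgc y x0)
  have hEi : Integrable (fun y => E.integral (g y)) μ :=
    hc.mono' hE (Eventually.of_forall fun y => norm_integral_le (hm y) (hc0 y) (hgc y))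
  have hprod : Integrable (Function.uncurry g) (μ.prod (E.diag v)) := by
    refine Integrable.mono' (hc.mul_prod (integrable_const (1 : ℝ)))
      hg.aestronglyMeasurable (Eventually.of_forall fun z => ?_)
    simpa [Function.uncurry] using hgc z.1 z.2
  refine ⟨hprod.integral_prod_right, ?_⟩
  have h1 := ContinuousLinearMap.integral_comp_comm
    ((innerSL ℂ v).comp (ContinuousLinearMap.apply ℂ H v)) hEi
  simp only [ContinuousLinearMap.comp_apply, ContinuousLinearMap.apply_apply,
    innerSL_apply_apply] at h1
  rw [← h1]
  simp_rw [fun y => (E.isIntegral_integral (hm y) (hgc y) v).2]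
  exact integral_integral_swap hprod

end ProjectionValuedMeasure

/-! ### Translations, smooth vectors and smooth bounded operators -/

namespace TranslationRep

variable {H : Type*} [NormedAddCommGroup H] [InnerProductSpace ℂ H] {d : ℕ}
  (U : TranslationRep d H)

lemma apply_zero (v : H) : U 0 v = v := by
  have h := U.map_add 0 0 v
  rw [add_zero] at h
  exact ((U 0).injective h).symm

lemma apply_neg_apply (x : EuclideanSpace ℝ (Fin d)) (v : H) : U (-x) (U x v) = v := by
  rw [← U.map_add, neg_add_cancel, U.apply_zero]

lemma apply_apply_neg (x : EuclideanSpace ℝ (Fin d)) (v : H) : U x (U (-x) v) = v := by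
  rw [← U.map_add, add_neg_cancel, U.apply_zero]

/-- The unitary `U(x)` as a bounded operator. -/
def op (x : EuclideanSpace ℝ (Fin d)) : H →L[ℂ] H := (U x).toContinuousLinearEquiv

@[simp] lemma op_apply (x : EuclideanSpace ℝ (Fin d)) (v : H) : U.op x v = U x v := rfl

lemma norm_op_le (x : EuclideanSpace ℝ (Fin d)) : ‖U.op x‖ ≤ 1 :=
  ContinuousLinearMap.opNorm_le_bound _ zero_le_one fun v => by simp

/-- The adjoint action `α_x(S) = U(x) S U(-x)` on bounded operators, as a continuous linear map. -/
def conj (x : EuclideanSpace ℝ (Fin d)) : (H →L[ℂ] H) →L[ℂ] (H →L[ℂ] H) :=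
  ContinuousLinearMap.mulLeftRight ℂ (H →L[ℂ] H) (U.op x) (U.op (-x))

@[simp] lemma conj_apply (x : EuclideanSpace ℝ (Fin d)) (S : H →L[ℂ] H) (v : H) :
    U.conj x S v = U x (S (U (-x) v)) := rfl

lemma norm_conj_le (x : EuclideanSpace ℝ (Fin d)) : ‖U.conj x‖ ≤ 1 := by
  refine (ContinuousLinearMap.opNorm_mulLeftRight_apply_apply_le ℂ (H →L[ℂ] H) _ _).trans ?_
  exact mul_le_one₀ (U.norm_op_le x) (norm_nonneg _) (U.norm_op_le (-x))

lemma norm_conj_apply_le (x : EuclideanSpace ℝ (Fin d)) (S : H →L[ℂ] H) :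
    ‖U.conj x S‖ ≤ ‖S‖ := by
  simpa using (U.conj x).le_of_opNorm_le (U.norm_conj_le x) S

lemma conj_zero (S : H →L[ℂ] H) : U.conj 0 S = S := by
  ext v; simp [apply_zero]

lemma conj_add (x y : EuclideanSpace ℝ (Fin d)) (S : H →L[ℂ] H) :
    U.conj (x + y) S = U.conj x (U.conj y S) := by
  ext v
  simp [U.map_add, neg_add_rev]

lemma conj_mul (x : EuclideanSpace ℝ (Fin d)) (S T : H →L[ℂ] H) :
    U.conj x (S * T) = U.conj x S * U.conj x T := by
  ext v
  simp [apply_neg_apply]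

lemma conj_apply_op (x : EuclideanSpace ℝ (Fin d)) (S : H →L[ℂ] H) (v : H) :
    U.conj x S (U x v) = U x (S v) := by
  rw [conj_apply, apply_neg_apply]

/-- The bounded operators `S` for which `x ↦ U(x) S U(-x)` is of class `C^∞` in norm. -/
def IsSmoothOp (S : H →L[ℂ] H) : Prop := ContDiff ℝ ∞ fun x => U.conj x S

variable {U}

lemma IsSmoothOp.add {S T : H →L[ℂ] H} (hS : U.IsSmoothOp S) (hT : U.IsSmoothOp T) :
    U.IsSmoothOp (S + T) := by
  unfold IsSmoothOp at *
  simpa only [_root_.map_add] using hS.add hT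

lemma IsSmoothOp.mul {S T : H →L[ℂ] H} (hS : U.IsSmoothOp S) (hT : U.IsSmoothOp T) :
    U.IsSmoothOp (S * T) := by
  unfold IsSmoothOp at *
  simpa only [conj_mul] using hS.mul hT

lemma isSmoothOp_of_commute {S : H →L[ℂ] H} (h : ∀ x v, U x (S v) = S (U x v)) :
    U.IsSmoothOp S := by
  have h1 : (fun x => U.conj x S) = fun _ => S := by
    ext x v
    rw [conj_apply, h, apply_apply_neg]
  rw [IsSmoothOp, h1]
  exact contDiff_const

variable (U) in
/-- The derivative of `x ↦ U(x) S U(-x)` at `0` in the direction `y`, that is, the commutator with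
`S` of the derivative of `t ↦ U(t y)` at `0`. -/
def derivOp (y : EuclideanSpace ℝ (Fin d)) (S : H →L[ℂ] H) : H →L[ℂ] H :=
  fderiv ℝ (fun x => U.conj x S) 0 y

lemma IsSmoothOp.conj_derivOp {S : H →L[ℂ] H} (hS : U.IsSmoothOp S)
    (x y : EuclideanSpace ℝ (Fin d)) :
    U.conj x (U.derivOp y S) = fderiv ℝ (fun z => U.conj z S) x y := by
  have hd : Differentiable ℝ (fun z => U.conj z S) := hS.differentiable (by simp)
  have h1 : HasFDerivAt (fun z => U.conj x (U.conj z S))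
      (((U.conj x).restrictScalars ℝ).comp (fderiv ℝ (fun z => U.conj z S) 0)) 0 :=
    ((U.conj x).restrictScalars ℝ).hasFDerivAt.comp (0 : EuclideanSpace ℝ (Fin d))
      (hd 0).hasFDerivAt
  have h2 : HasFDerivAt (fun z => U.conj (x + z) S) (fderiv ℝ (fun z => U.conj z S) x) 0 := by
    have h3 : HasFDerivAt (fun z => U.conj z S) (fderiv ℝ (fun z => U.conj z S) x) (x + 0) := by
      rw [add_zero]; exact (hd x).hasFDerivAt
    exact h3.comp (0 : EuclideanSpace ℝ (Fin d)) ((hasFDerivAt_id _).const_add x)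
  simp only [conj_add] at h2
  exact congrArg (fun L => L y) (h1.unique h2)

lemma IsSmoothOp.derivOp {S : H →L[ℂ] H} (hS : U.IsSmoothOp S)
    (y : EuclideanSpace ℝ (Fin d)) : U.IsSmoothOp (U.derivOp y S) := by
  have h1 : (fun x => U.conj x (U.derivOp y S)) = fun x => fderiv ℝ (fun z => U.conj z S) x y :=
    funext fun x => hS.conj_derivOp x y
  rw [IsSmoothOp, h1]
  exact (hS.fderiv_right (m := ∞) (by simp)).clm_apply contDiff_const

lemma IsSmoothOp.continuous {S : H →L[ℂ] H} (hS : U.IsSmoothOp S) :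
    Continuous fun x => U.conj x S := ContDiff.continuous hS

/-- All derivatives of `x ↦ U(x) S U(-x)` are bounded, by translation invariance. -/
lemma IsSmoothOp.norm_iteratedFDeriv_le {S : H →L[ℂ] H} (hS : U.IsSmoothOp S) (n : ℕ)
    (x : EuclideanSpace ℝ (Fin d)) :
    ‖iteratedFDeriv ℝ n (fun z => U.conj z S) x‖ ≤
      ‖iteratedFDeriv ℝ n (fun z => U.conj z S) 0‖ := by
  have h1 : iteratedFDeriv ℝ n (fun z => U.conj (x + z) S) 0 =
      iteratedFDeriv ℝ n (fun z => U.conj z S) x := by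
    have := iteratedFDeriv_comp_add_left (𝕜 := ℝ) (f := fun z => U.conj z S) n x
    rw [this 0, add_zero]
  rw [← h1]
  simp only [conj_add]
  have h2 := ((U.conj x).restrictScalars ℝ).norm_iteratedFDeriv_comp_left
    (f := fun z => U.conj z S) (x := 0) (n := n) (ContDiff.contDiffAt hS)
    (by exact_mod_cast le_top)
  refine h2.trans ?_
  rw [ContinuousLinearMap.norm_restrictScalars]
  exact mul_le_of_le_one_left (norm_nonneg _) (U.norm_conj_le x)

variable (U) in
/-- The smooth vectors are dense: averages `∫ f(t) U(-t) u dt` of a vector over a test function are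
smooth, and they approximate `u`. -/
lemma dense_smoothVectors [CompleteSpace H] : Dense (U.smoothVectors : Set H) := by
  intro u
  let φ : ℕ → ContDiffBump (0 : EuclideanSpace ℝ (Fin d)) := fun n =>
    ⟨1 / ((n : ℝ) + 1), 2 * (1 / ((n : ℝ) + 1)), by positivity,
      by have : 0 < 1 / ((n : ℝ) + 1) := by positivity
         linarith⟩
  have hφ : Tendsto (fun n => (φ n).rOut) atTop (𝓝 0) := by
    simpa only [mul_zero] using
      (tendsto_one_div_add_atTop_nhds_zero_nat (𝕜 := ℝ)).const_mul (2 : ℝ)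
  have h1 := ContDiffBump.convolution_tendsto_right_of_continuous (μ := volume) hφ
    (U.continuous u) 0
  rw [U.apply_zero] at h1
  refine mem_closure_of_tendsto h1 (Eventually.of_forall fun n => ?_)
  rw [SetLike.mem_coe, mem_smoothVectors]
  have h2 : ContDiff ℝ ∞ (convolution ((φ n).normed volume) (fun x => U x u)
      (ContinuousLinearMap.lsmul ℝ ℝ) volume) :=
    (φ n).hasCompactSupport_normed.contDiff_convolution_left _ (φ n).contDiff_normed
      (U.continuous u).locallyIntegrable
  convert h2 using 2 with x
  have hi : Integrable fun t => (φ n).normed volume t • U (0 - t) u := by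
    refine Continuous.integrable_of_hasCompactSupport ?_ ?_
    · exact (φ n).contDiff_normed (n := 0).continuous.smul ((U.continuous u).comp (by fun_prop))
    · exact (φ n).hasCompactSupport_normed.smul_right
  have h3 := ((U.op x).restrictScalars ℝ).integral_comp_comm hi
  simp only [convolution, ContinuousLinearMap.lsmul_apply]
  refine h3.symm.trans (integral_congr_ae (Eventually.of_forall fun t => ?_))
  simp [← U.map_add, sub_eq_add_neg]

end TranslationRep

section Resolvents

variable {H : Type*} [NormedAddCommGroup H] [InnerProductSpace ℂ H] {d : ℕ}

/-! ### Resolvents of the generators -/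

/-- A bounded operator `K` commuting with translations, such that every smooth vector is in `K 𝒟`,
and such that `T K` is of the form `K T'` with a smooth `T'` if `T` is smooth. -/
structure IsRegularizer (U : TranslationRep d H) (K : H →L[ℂ] H) : Prop where
  comm : ∀ x v, U x (K v) = K (U x v)
  exists_apply_eq : ∀ v ∈ U.smoothVectors, ∃ w ∈ U.smoothVectors, K w = v
  exists_mul_eq : ∀ T, U.IsSmoothOp T → ∃ T', U.IsSmoothOp T' ∧ T * K = K * T'

lemma IsRegularizer.id (U : TranslationRep d H) :
    IsRegularizer U (ContinuousLinearMap.id ℂ H) where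
  comm _ _ := rfl
  exists_apply_eq v hv := ⟨v, hv, rfl⟩
  exists_mul_eq T hT := ⟨T, hT, rfl⟩

lemma IsRegularizer.mul {U : TranslationRep d H} {K L : H →L[ℂ] H} (hK : IsRegularizer U K)
    (hL : IsRegularizer U L) : IsRegularizer U (K * L) where
  comm x v := by rw [mul_apply_eq_comp, mul_apply_eq_comp, hK.comm, hL.comm]
  exists_apply_eq v hv := by
    obtain ⟨w, hw, rfl⟩ := hK.exists_apply_eq v hv
    obtain ⟨u, hu, rfl⟩ := hL.exists_apply_eq w hw
    exact ⟨u, hu, rfl⟩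
  exists_mul_eq T hT := by
    obtain ⟨T', hT', h1⟩ := hK.exists_mul_eq T hT
    obtain ⟨T'', hT'', h2⟩ := hL.exists_mul_eq T' hT'
    exact ⟨T'', hT'', by rw [← mul_assoc, h1, mul_assoc, h2, mul_assoc]⟩

/-- The function `p ↦ (1 + i pⱼ)⁻¹`, whose spectral integral is a resolvent of the generator of the
translations in a direction `y` with `y p = pⱼ`. -/
def resolventFun (j : Fin d) (p : EuclideanSpace ℝ (Fin d)) : ℂ := (1 + Complex.I * (p j : ℂ))⁻¹

lemma one_add_I_mul_ne_zero (t : ℝ) : 1 + Complex.I * (t : ℂ) ≠ 0 := fun h => by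
  simpa using congrArg Complex.re h

lemma norm_sq_one_add_I_mul (t : ℝ) : ‖1 + Complex.I * (t : ℂ)‖ ^ 2 = 1 + t ^ 2 := by
  rw [← Complex.normSq_eq_norm_sq, Complex.normSq_apply]
  simp; ring

lemma norm_sq_resolventFun (j : Fin d) (p : EuclideanSpace ℝ (Fin d)) :
    ‖resolventFun j p‖ ^ 2 = (1 + p j ^ 2)⁻¹ := by
  rw [resolventFun, norm_inv, inv_pow, norm_sq_one_add_I_mul]

lemma norm_resolventFun_le (j : Fin d) (p : EuclideanSpace ℝ (Fin d)) :
    ‖resolventFun j p‖ ≤ 1 := by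
  refine le_of_sq_le_sq ?_ zero_le_one
  rw [norm_sq_resolventFun, one_pow]
  exact inv_le_one_of_one_le₀ (by linarith [sq_nonneg (p j)])

lemma norm_mul_resolventFun_le (j : Fin d) (p : EuclideanSpace ℝ (Fin d)) :
    ‖(p j : ℂ) * resolventFun j p‖ ≤ 1 := by
  refine le_of_sq_le_sq ?_ zero_le_one
  rw [norm_mul, mul_pow, norm_sq_resolventFun, one_pow, Complex.norm_real, Real.norm_eq_abs,
    sq_abs, mul_inv_le_iff₀ (by positivity)]
  linarith

lemma measurable_resolventFun (j : Fin d) : Measurable (resolventFun (d := d) j) := by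
  unfold resolventFun
  fun_prop

/-- The function `p ↦ ∏ⱼ (1 + i pⱼ)⁻¹`. -/
def resolventProd (d : ℕ) (p : EuclideanSpace ℝ (Fin d)) : ℂ := ∏ j, resolventFun j p

lemma measurable_resolventProd : Measurable (resolventProd d) :=
  Finset.measurable_fun_prod _ fun j _ => measurable_resolventFun j

lemma one_add_sum_le_prod {ι : Type*} (s : Finset ι) (a : ι → ℝ) (ha : ∀ i, 0 ≤ a i) :
    1 + ∑ i ∈ s, a i ≤ ∏ i ∈ s, (1 + a i) := by
  classical
  induction s using Finset.induction_on with
  | empty => simp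
  | insert i s hi ih =>
    rw [Finset.sum_insert hi, Finset.prod_insert hi]
    have h1 : 0 ≤ ∑ i ∈ s, a i := Finset.sum_nonneg fun i _ => ha i
    have h2 := mul_le_mul_of_nonneg_left ih (by linarith [ha i] : 0 ≤ 1 + a i)
    nlinarith [mul_nonneg (ha i) h1]

/-- `|∏ⱼ (1 + i pⱼ)⁻¹|² ≤ (1 + |p|²)⁻¹`, so powers of this product decay like a damping function. -/
lemma norm_sq_resolventProd_le (p : EuclideanSpace ℝ (Fin d)) :
    ‖resolventProd d p‖ ^ 2 ≤ (1 + ‖p‖ ^ 2)⁻¹ := by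
  rw [resolventProd, norm_prod, ← Finset.prod_pow]
  simp_rw [norm_sq_resolventFun]
  rw [Finset.prod_inv_distrib, EuclideanSpace.real_norm_sq_eq]
  refine inv_anti₀ ?_ (one_add_sum_le_prod _ _ fun j => sq_nonneg _)
  have : 0 ≤ ∑ j, p j ^ 2 := Finset.sum_nonneg fun j _ => sq_nonneg _
  linarith

lemma norm_resolventProd_le (p : EuclideanSpace ℝ (Fin d)) : ‖resolventProd d p‖ ≤ 1 := by
  refine le_of_sq_le_sq ?_ zero_le_one
  rw [one_pow]
  exact (norm_sq_resolventProd_le p).trans (inv_le_one_of_one_le₀ (by linarith [sq_nonneg ‖p‖]))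

namespace SpectralResolution

variable [CompleteSpace H]
  {B : LinearMap.BilinForm ℝ (EuclideanSpace ℝ (Fin d))} {U : TranslationRep d H}
  (E : SpectralResolution B U)

/-- A bilinear form on `ℝ^d` is jointly continuous. -/
lemma continuous_form (B : LinearMap.BilinForm ℝ (EuclideanSpace ℝ (Fin d))) :
    Continuous fun z : EuclideanSpace ℝ (Fin d) × EuclideanSpace ℝ (Fin d) => B z.1 z.2 := by
  have h : Continuous fun p => LinearMap.toContinuousLinearMap (B p) :=
    (LinearMap.toContinuousLinearMap.toLinearMap ∘ₗ B).continuous_of_finiteDimensional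
  exact (h.comp continuous_fst).clm_apply continuous_snd

/-- The character `p ↦ exp(i B(p, x))`. -/
def phase (B : LinearMap.BilinForm ℝ (EuclideanSpace ℝ (Fin d)))
    (x p : EuclideanSpace ℝ (Fin d)) : ℂ := Complex.exp (Complex.I * (B p x : ℂ))

lemma norm_phase (x p : EuclideanSpace ℝ (Fin d)) : ‖phase B x p‖ = 1 :=
  Complex.norm_exp_I_mul_ofReal _

lemma continuous_phase :
    Continuous fun z : EuclideanSpace ℝ (Fin d) × EuclideanSpace ℝ (Fin d) => phase B z.1 z.2 := by
  unfold phase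
  exact Complex.continuous_exp.comp (continuous_const.mul
    (Complex.continuous_ofReal.comp ((continuous_form B).comp continuous_swap)))

lemma measurable_phase (x : EuclideanSpace ℝ (Fin d)) : Measurable (phase B x) :=
  (continuous_phase.comp (Continuous.prodMk_right x)).measurable

lemma integral_phase (x : EuclideanSpace ℝ (Fin d)) : E.integral (phase B x) = U.op x :=
  (E.isIntegral x).integral_eq

/-- Vectors in the range of the resolvent `r` are differentiable under translations, with
derivative `u - r u` at `r u`, as `i pⱼ (1 + i pⱼ)⁻¹ = 1 - (1 + i pⱼ)⁻¹`. -/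
lemma hasDerivAt_apply_resolvent {j : Fin d} {y : EuclideanSpace ℝ (Fin d)}
    (hy : ∀ p, B p y = p j) (u : H) :
    HasDerivAt (fun t : ℝ => U (t • y) (E.integral (resolventFun j) u))
      (u - E.integral (resolventFun j) u) 0 := by
  rw [hasDerivAt_iff_tendsto_slope_zero]
  simp only [zero_add, zero_smul, U.apply_zero]
  have hρ := measurable_resolventFun (d := d) j
  have hρ1 := norm_resolventFun_le (d := d) j
  have hlim : u - E.integral (resolventFun j) u = E.integral (fun p => 1 - resolventFun j p) u := by
    rw [ProjectionValuedMeasure.integral_sub_eq measurable_const (C := 1) (by simp) hρ hρ1,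
      ProjectionValuedMeasure.isIntegral_one.integral_eq]
    rfl
  let g : ℝ → EuclideanSpace ℝ (Fin d) → ℂ := fun t p =>
    ((t⁻¹ : ℝ) : ℂ) * ((phase B (t • y) p - 1) * resolventFun j p)
  have hg : ∀ t, Measurable (g t) := fun t =>
    (((measurable_phase _).sub_const 1).mul hρ).const_mul _
  have hph : ∀ t p, phase B (t • y) p = Complex.exp (Complex.I * ((t * p j : ℝ) : ℂ)) := by
    intro t p
    rw [phase, _root_.map_smul, hy, smul_eq_mul]
  have hgb : ∀ t p, ‖g t p‖ ≤ 1 := fun t p => by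
    refine le_trans ?_ (norm_mul_resolventFun_le j p)
    rw [norm_mul, norm_mul, norm_mul, ← mul_assoc]
    gcongr
    rw [hph]
    refine (mul_le_mul_of_nonneg_left (Real.norm_exp_I_mul_ofReal_sub_one_le)
      (norm_nonneg _)).trans ?_
    rw [Complex.norm_real, Complex.norm_real, norm_inv, norm_mul]
    rcases eq_or_ne t 0 with rfl | ht
    · simp
    · rw [← mul_assoc, inv_mul_cancel₀ (norm_ne_zero_iff.2 ht), one_mul]
  have heq : ∀ t : ℝ, t⁻¹ • (U (t • y) (E.integral (resolventFun j) u) -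
      E.integral (resolventFun j) u) = E.integral (g t) u := fun t => by
    have h1 : ∀ p, ‖phase B (t • y) p - 1‖ ≤ 1 + 1 := fun p =>
      (norm_sub_le _ _).trans (by rw [norm_phase, norm_one])
    have h2 : ∀ p, ‖(phase B (t • y) p - 1) * resolventFun j p‖ ≤ (1 + 1) * 1 := fun p => by
      rw [norm_mul]
      exact mul_le_mul (h1 p) (hρ1 p) (norm_nonneg _) (by norm_num)
    have hm := (measurable_phase (B := B) (t • y)).sub_const 1
    rw [ProjectionValuedMeasure.integral_const_mul_eq
        (f := fun p => (phase B (t • y) p - 1) * resolventFun j p) (hm.mul hρ) h2,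
      ProjectionValuedMeasure.integral_mul hm h1 hρ hρ1,
      ProjectionValuedMeasure.integral_sub_eq (measurable_phase _) (C := 1)
        (fun p => (norm_phase _ p).le) measurable_const (C' := 1) (by simp),
      ProjectionValuedMeasure.isIntegral_one.integral_eq, E.integral_phase, smul_apply,
      Complex.coe_smul]
    rfl
  simp_rw [heq]
  rw [hlim]
  refine ProjectionValuedMeasure.tendsto_integral_apply hg (hρ.const_sub 1) (C := 1 + 1)
    (fun t p => (hgb t p).trans (by norm_num))
    (fun p => (norm_sub_le _ _).trans (by rw [norm_one]; linarith [hρ1 p])) (fun p => ?_) u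
  have hd : HasDerivAt (fun t : ℝ => Complex.exp (Complex.I * ((t * p j : ℝ) : ℂ)))
      (Complex.I * (p j : ℂ)) 0 := by
    have h1 : HasDerivAt (fun t : ℝ => Complex.I * ((t * p j : ℝ) : ℂ))
        (Complex.I * (p j : ℂ)) 0 := by
      have := ((hasDerivAt_id (0 : ℝ)).mul_const (p j)).ofReal_comp.const_mul Complex.I
      simpa using this
    simpa using h1.cexp
  rw [hasDerivAt_iff_tendsto_slope_zero] at hd
  have h2 := hd.mul_const (resolventFun j p)
  have h3 : Complex.I * (p j : ℂ) * resolventFun j p = 1 - resolventFun j p := by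
    rw [resolventFun]
    field_simp [one_add_I_mul_ne_zero (p j)]
    ring
  rw [h3] at h2
  refine h2.congr fun t => ?_
  simp only [g, hph, zero_add, zero_mul, Complex.ofReal_zero, mul_zero, Complex.exp_zero,
    Complex.real_smul]
  ring

/-- Conversely, a vector `v` with derivative `v'` under translations is `r (v + v')`. -/
lemma resolvent_of_hasDerivAt {j : Fin d} {y : EuclideanSpace ℝ (Fin d)}
    (hy : ∀ p, B p y = p j) {v v' : H} (h : HasDerivAt (fun t : ℝ => U (t • y) v) v' 0) :
    E.integral (resolventFun j) (v + v') = v := by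
  have h1 := ((E.integral (resolventFun j)).restrictScalars ℝ).hasFDerivAt.comp_hasDerivAt
    (0 : ℝ) h
  have h2 := E.hasDerivAt_apply_resolvent hy v
  simp only [E.integral_comm] at h2
  have h3 : E.integral (resolventFun j) v' = v - E.integral (resolventFun j) v := h1.unique h2
  rw [_root_.map_add, h3, add_sub_cancel]

/-- If `T` is smooth and `r` is the resolvent of a generator `P`, then `T r = r (T + [iP, T] r)`. -/
lemma mul_resolvent {j : Fin d} {y : EuclideanSpace ℝ (Fin d)} (hy : ∀ p, B p y = p j)
    {T : H →L[ℂ] H} (hT : U.IsSmoothOp T) :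
    T * E.integral (resolventFun j) = E.integral (resolventFun j) *
      (T + U.derivOp y T * E.integral (resolventFun j)) := by
  ext u
  set r := E.integral (resolventFun (d := d) j)
  have h1 : HasDerivAt (fun t : ℝ => U.conj (t • y) T) (U.derivOp y T) 0 := by
    have h0 : HasFDerivAt (fun x => U.conj x T) (fderiv ℝ (fun x => U.conj x T) 0)
        ((0 : ℝ) • y) := by
      rw [zero_smul]
      exact (hT.differentiable (by simp) 0).hasFDerivAt
    have h2 : HasDerivAt (fun t : ℝ => t • y) y 0 := by
      simpa using (hasDerivAt_id (0 : ℝ)).smul_const y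
    exact h0.comp_hasDerivAt (0 : ℝ) h2
  have h2 := E.hasDerivAt_apply_resolvent hy u
  have h3 := (((ContinuousLinearMap.restrictScalarsL ℂ H H ℝ ℝ).hasFDerivAt.comp_hasDerivAt
    (0 : ℝ) h1)).clm_apply h2
  have h4 : HasDerivAt (fun t : ℝ => U (t • y) (T (r u)))
      (U.derivOp y T (r u) + T (u - r u)) 0 := by
    convert h3 using 1
    · ext t
      exact (U.conj_apply_op (t • y) T (r u)).symm
    · simp [U.apply_zero, U.conj_zero, r]
  have h5 := E.resolvent_of_hasDerivAt hy h4
  rw [mul_apply_eq_comp, mul_apply_eq_comp, add_apply, mul_apply_eq_comp, ← h5, map_sub]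
  congr 1
  abel

lemma isRegularizer_resolvent (hB : B.IsSymm) (hB' : B.Nondegenerate) (j : Fin d) :
    IsRegularizer U (E.integral (resolventFun j)) := by
  -- nondegeneracy: the coordinate `pⱼ` is `B(p, y)` for some direction `y`
  obtain ⟨y, hy⟩ : ∃ y, ∀ p, B p y = p j := by
    refine ⟨(LinearMap.BilinForm.toDual B hB').symm
      (EuclideanSpace.proj j : EuclideanSpace ℝ (Fin d) →L[ℝ] ℝ).toLinearMap, fun p => ?_⟩
    rw [← hB.eq, LinearMap.BilinForm.apply_toDual_symm_apply]
    rfl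
  refine ⟨fun x v => E.integral_comm _ x v, fun v hv => ?_, fun T hT =>
    ⟨_, hT.add ((hT.derivOp y).mul
      (TranslationRep.isSmoothOp_of_commute fun x v => E.integral_comm _ x v)),
      E.mul_resolvent hy hT⟩⟩
  rw [U.mem_smoothVectors] at hv
  have hd : Differentiable ℝ fun x => U x v := hv.differentiable (by simp)
  -- `v = r (v + v')` for the derivative `v'` of `v`, which is again a smooth vector
  let v' := fderiv ℝ (fun x => U x v) 0 y
  have h1 : HasDerivAt (fun t : ℝ => U (t • y) v) v' 0 := by
    have h0 : HasFDerivAt (fun x => U x v) (fderiv ℝ (fun x => U x v) 0) ((0 : ℝ) • y) := by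
      rw [zero_smul]
      exact (hd 0).hasFDerivAt
    have h2 : HasDerivAt (fun t : ℝ => t • y) y 0 := by
      simpa using (hasDerivAt_id (0 : ℝ)).smul_const y
    exact h0.comp_hasDerivAt (0 : ℝ) h2
  refine ⟨v + v', U.smoothVectors.add_mem hv ?_, E.resolvent_of_hasDerivAt hy h1⟩
  rw [U.mem_smoothVectors]
  have h2 : (fun x => U x v') = fun x => fderiv ℝ (fun x => U x v) x y := funext fun x => by
    have h3 : HasFDerivAt (fun z => U x (U z v)) (((U.op x).restrictScalars ℝ).comp
        (fderiv ℝ (fun z => U z v) 0)) 0 :=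
      ((U.op x).restrictScalars ℝ).hasFDerivAt.comp (0 : EuclideanSpace ℝ (Fin d))
        (hd 0).hasFDerivAt
    have h4 : HasFDerivAt (fun z => U (x + z) v) (fderiv ℝ (fun z => U z v) x) 0 := by
      have h5 : HasFDerivAt (fun z => U z v) (fderiv ℝ (fun z => U z v) x) (x + 0) := by
        rw [add_zero]; exact (hd x).hasFDerivAt
      exact h5.comp (0 : EuclideanSpace ℝ (Fin d)) ((hasFDerivAt_id _).const_add x)
    simp only [U.map_add] at h4
    exact congrArg (fun L => L y) (h3.unique h4)
  rw [h2]
  exact (hv.fderiv_right (m := ∞) (by simp)).clm_apply contDiff_const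

lemma isRegularizer_resolventProd (hB : B.IsSymm) (hB' : B.Nondegenerate) :
    IsRegularizer U (E.integral (resolventProd d)) := by
  classical
  suffices h : ∀ s : Finset (Fin d),
      IsRegularizer U (E.integral fun p => ∏ j ∈ s, resolventFun j p) from h Finset.univ
  intro s
  induction s using Finset.induction_on with
  | empty =>
    simp only [Finset.prod_empty, ProjectionValuedMeasure.isIntegral_one.integral_eq]
    exact IsRegularizer.id U
  | insert j s hj ih =>
    simp only [Finset.prod_insert hj]
    rw [ProjectionValuedMeasure.integral_mul (measurable_resolventFun j) (norm_resolventFun_le j)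
      (Finset.measurable_fun_prod _ fun j _ => measurable_resolventFun j) (C' := 1)]
    · exact (E.isRegularizer_resolvent hB hB' j).mul ih
    · intro p
      rw [norm_prod]
      exact Finset.prod_le_one (fun _ _ => norm_nonneg _) fun j _ => norm_resolventFun_le j p

lemma norm_resolventProd_pow_le (n : ℕ) (p : EuclideanSpace ℝ (Fin d)) :
    ‖resolventProd d p ^ n‖ ≤ 1 := by
  rw [norm_pow]
  exact pow_le_one₀ (norm_nonneg _) (norm_resolventProd_le p)

lemma integral_resolventProd_pow_add (m n : ℕ) :
    E.integral (fun p => resolventProd d p ^ (m + n)) =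
      E.integral (fun p => resolventProd d p ^ m) *
        E.integral (fun p => resolventProd d p ^ n) := by
  simp only [pow_add]
  exact ProjectionValuedMeasure.integral_mul (measurable_resolventProd.pow_const m)
    (norm_resolventProd_pow_le m) (measurable_resolventProd.pow_const n)
    (norm_resolventProd_pow_le n)

lemma isRegularizer_resolventProd_pow (hB : B.IsSymm) (hB' : B.Nondegenerate) (n : ℕ) :
    IsRegularizer U (E.integral fun p => resolventProd d p ^ n) := by
  induction n with
  | zero =>
    simp only [pow_zero, ProjectionValuedMeasure.isIntegral_one.integral_eq]
    exact IsRegularizer.id U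
  | succ n ih =>
    rw [E.integral_resolventProd_pow_add]
    simp only [pow_one]
    exact ih.mul (E.isRegularizer_resolventProd hB hB')

end SpectralResolution

end Resolvents

/-! ### The damping functions -/

section Damping

variable {d : ℕ}

/-- The function `p ↦ (1 + |p|²)⁻ⁿ` with real values. -/
def realDamping (d n : ℕ) (p : EuclideanSpace ℝ (Fin d)) : ℝ := ((1 + ‖p‖ ^ 2) ^ n)⁻¹

lemma damping_eq_ofReal (n : ℕ) (p : EuclideanSpace ℝ (Fin d)) :
    damping d n p = (realDamping d n p : ℂ) := rfl

lemma realDamping_pos (n : ℕ) (p : EuclideanSpace ℝ (Fin d)) : 0 < realDamping d n p := by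
  unfold realDamping; positivity

lemma realDamping_le_one (n : ℕ) (p : EuclideanSpace ℝ (Fin d)) : realDamping d n p ≤ 1 :=
  inv_le_one_of_one_le₀ (one_le_pow₀ (by linarith [sq_nonneg ‖p‖]))

lemma norm_damping (n : ℕ) (p : EuclideanSpace ℝ (Fin d)) :
    ‖damping d n p‖ = realDamping d n p := by
  rw [damping_eq_ofReal, Complex.norm_real, Real.norm_of_nonneg (realDamping_pos n p).le]

lemma norm_damping_le (n : ℕ) (p : EuclideanSpace ℝ (Fin d)) : ‖damping d n p‖ ≤ 1 := by
  rw [norm_damping]; exact realDamping_le_one n p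

lemma damping_ne_zero (n : ℕ) (p : EuclideanSpace ℝ (Fin d)) : damping d n p ≠ 0 := by
  rw [← norm_pos_iff, norm_damping]
  exact realDamping_pos n p

lemma realDamping_add (m n : ℕ) (p : EuclideanSpace ℝ (Fin d)) :
    realDamping d (m + n) p = realDamping d m p * realDamping d n p := by
  rw [realDamping, pow_add, mul_inv]; rfl

lemma continuous_realDamping (n : ℕ) : Continuous (realDamping d n) := by
  unfold realDamping
  exact Continuous.inv₀ (by fun_prop) fun p => by positivity

lemma continuous_damping (n : ℕ) : Continuous (damping d n) :=
  Complex.continuous_ofReal.comp (continuous_realDamping n)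

lemma measurable_damping (n : ℕ) : Measurable (damping d n) := (continuous_damping n).measurable

lemma integrable_realDamping {n : ℕ} (hn : d < n) : Integrable (realDamping d n) := by
  have h := integrable_rpow_neg_one_add_norm_sq (E := EuclideanSpace ℝ (Fin d)) (μ := volume)
    (r := 2 * n) (by
      rw [finrank_euclideanSpace_fin]
      have : (d : ℝ) < n := by exact_mod_cast hn
      linarith [n.cast_nonneg (α := ℝ)])
  refine h.congr (Eventually.of_forall fun p => ?_)
  have h1 : -(2 * (n : ℝ)) / 2 = -(n : ℝ) := by ring
  simp only [h1]
  rw [Real.rpow_neg (by positivity), Real.rpow_natCast, realDamping]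

/-- Peetre's inequality. -/
lemma realDamping_le_mul (n : ℕ) (p q : EuclideanSpace ℝ (Fin d)) :
    realDamping d n q ≤ (2 * (1 + ‖p - q‖ ^ 2)) ^ n * realDamping d n p := by
  unfold realDamping
  rw [← div_eq_mul_inv, le_div_iff₀ (by positivity), inv_mul_le_iff₀ (by positivity), ← mul_pow]
  refine pow_le_pow_left₀ (by positivity) ?_ n
  have h : ‖p‖ ≤ ‖q‖ + ‖p - q‖ := by
    calc ‖p‖ = ‖q + (p - q)‖ := by rw [add_sub_cancel]
      _ ≤ _ := norm_add_le _ _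
  have h2 : ‖p‖ ^ 2 ≤ (‖q‖ + ‖p - q‖) ^ 2 := pow_le_pow_left₀ (norm_nonneg _) h 2
  nlinarith [sq_nonneg (‖q‖ - ‖p - q‖), mul_nonneg (sq_nonneg ‖q‖) (sq_nonneg ‖p - q‖)]

lemma norm_resolventProd_pow_le_realDamping (n : ℕ) (p : EuclideanSpace ℝ (Fin d)) :
    ‖resolventProd d p ^ (2 * n)‖ ≤ realDamping d n p := by
  rw [norm_pow, pow_mul, realDamping, ← inv_pow]
  exact pow_le_pow_left₀ (by positivity) (norm_sq_resolventProd_le p) n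

/-- The quotient `(∏ⱼ (1 + i pⱼ)⁻¹)²ⁿ / (1 + |p|²)⁻ⁿ`, which is bounded by `1`. -/
def resolventQuotient (d n : ℕ) (p : EuclideanSpace ℝ (Fin d)) : ℂ :=
  (damping d n p)⁻¹ * resolventProd d p ^ (2 * n)

lemma norm_resolventQuotient_le (n : ℕ) (p : EuclideanSpace ℝ (Fin d)) :
    ‖resolventQuotient d n p‖ ≤ 1 := by
  rw [resolventQuotient, norm_mul, norm_inv, norm_damping, inv_mul_le_iff₀ (realDamping_pos n p),
    mul_one]
  exact norm_resolventProd_pow_le_realDamping n p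

lemma measurable_resolventQuotient (n : ℕ) : Measurable (resolventQuotient d n) :=
  (measurable_damping n).inv.mul (measurable_resolventProd.pow_const _)

lemma damping_mul_resolventQuotient (n : ℕ) (p : EuclideanSpace ℝ (Fin d)) :
    damping d n p * resolventQuotient d n p = resolventProd d p ^ (2 * n) := by
  rw [resolventQuotient, mul_inv_cancel_left₀ (damping_ne_zero n p)]

end Damping

/-! ### Translation-smooth operators in terms of smooth bounded operators -/

namespace SpectralResolution

variable {H : Type*} [NormedAddCommGroup H] [InnerProductSpace ℂ H] [CompleteSpace H] {d : ℕ}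
  {B : LinearMap.BilinForm ℝ (EuclideanSpace ℝ (Fin d))} {U : TranslationRep d H}
  (E : SpectralResolution B U)

@[simp] lemma coe_onSmooth (f : EuclideanSpace ℝ (Fin d) → ℂ) (v : U.smoothVectors) :
    (E.onSmooth f v : H) = E.integral f v := rfl

lemma integral_damping_mul_resolventQuotient (n : ℕ) :
    E.integral (damping d n) * E.integral (resolventQuotient d n) =
      E.integral fun p => resolventProd d p ^ (2 * n) := by
  rw [← ProjectionValuedMeasure.integral_mul (measurable_damping n) (norm_damping_le n)
    (measurable_resolventQuotient n) (norm_resolventQuotient_le n)]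
  simp only [damping_mul_resolventQuotient]

lemma integral_damping_injective (n : ℕ) : Function.Injective (E.integral (damping d n)) :=
  ProjectionValuedMeasure.integral_injective (measurable_damping n) (norm_damping_le n)
    (damping_ne_zero n)

/-- Every smooth vector is of the form `(1 + |P|²)⁻ⁿ w` with a smooth vector `w`. -/
lemma exists_damping_eq (hB : B.IsSymm) (hB' : B.Nondegenerate) (n : ℕ) {v : H}
    (hv : v ∈ U.smoothVectors) : ∃ w ∈ U.smoothVectors, E.integral (damping d n) w = v := by
  obtain ⟨w, hw, rfl⟩ := (E.isRegularizer_resolventProd_pow hB hB' (2 * n)).exists_apply_eq v hv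
  refine ⟨_, E.integral_mem_smoothVectors (resolventQuotient d n) hw, ?_⟩
  rw [← E.integral_damping_mul_resolventQuotient, mul_apply_eq_comp]

lemma adjointAction_apply_onSmooth (F : U.smoothVectors →ₗ[ℂ] H) (f : EuclideanSpace ℝ (Fin d) → ℂ)
    (x : EuclideanSpace ℝ (Fin d)) (w : U.smoothVectors) :
    U.adjointAction x F (E.onSmooth f w) = U x (F (E.onSmooth f (U.onSmooth (-x) w))) := by
  have h : U.onSmooth (-x) (E.onSmooth f w) = E.onSmooth f (U.onSmooth (-x) w) :=
    Subtype.ext (E.integral_comm f (-x) w)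
  rw [← h]
  rfl

/-- A translation-smooth operator becomes a smooth bounded operator when it is multiplied from the
right by a high power of the resolvents of the generators. -/
lemma exists_isSmoothOp_eq (hB : B.IsSymm) (hB' : B.Nondegenerate) {F : H →ₗ.[ℂ] H}
    (hF : IsTranslationSmooth E F) : ∃ (N : ℕ) (S : H →L[ℂ] H), U.IsSmoothOp S ∧
      ∀ (x : EuclideanSpace ℝ (Fin d)) (w : U.smoothVectors),
        U.adjointAction x (restrictSmooth U F hF.le_domain)
          (E.onSmooth (fun p => resolventProd d p ^ N) w) = U.conj x S w := by
  obtain ⟨n, T, hT, hTF⟩ := hF.exists_smooth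
  set G := restrictSmooth U F hF.le_domain
  have hT0 : ∀ w : U.smoothVectors,
      T 0 w = E.integral (damping d n) (G (E.onSmooth (damping d n) w)) := fun w => by
    rw [hTF, E.adjointAction_apply_onSmooth, U.apply_zero]
    have h : U.onSmooth (-0) w = w := Subtype.ext (by
      change U (-0) (w : H) = w
      rw [neg_zero, U.apply_zero])
    rw [h]
  -- the given smooth family is the orbit of `T 0`, as the smooth vectors are dense
  have hconj : ∀ x, U.conj x (T 0) = T x := fun x => by
    refine DFunLike.ext' (Continuous.ext_on U.dense_smoothVectors (U.conj x (T 0)).continuous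
      (T x).continuous fun w hw => ?_)
    have h1 := hT0 (U.onSmooth (-x) ⟨w, hw⟩)
    have h2 := hTF x ⟨w, hw⟩
    rw [E.adjointAction_apply_onSmooth, ← E.integral_comm, ← h1] at h2
    exact h2.symm
  have hTs : U.IsSmoothOp (T 0) := by
    unfold TranslationRep.IsSmoothOp
    simpa only [hconj] using hT
  -- with `R = (1 + |P|²)⁻ⁿ`, `T = R F R`, `K = R b` and `T K = K S`, one gets `F K² = b S b`
  obtain ⟨S, hS, hTS⟩ :=
    (E.isRegularizer_resolventProd_pow hB hB' (2 * n)).exists_mul_eq _ hTs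
  set K := E.integral fun p => resolventProd d p ^ (2 * n) with hK
  set R := E.integral (damping d n) with hR
  set b := E.integral (resolventQuotient d n) with hb
  have hRb : R * b = K := E.integral_damping_mul_resolventQuotient n
  have hbs : U.IsSmoothOp b := TranslationRep.isSmoothOp_of_commute fun x v => E.integral_comm _ x v
  refine ⟨2 * n + 2 * n, b * S * b, (hbs.mul hS).mul hbs, fun x w => ?_⟩
  rw [E.adjointAction_apply_onSmooth, TranslationRep.conj_apply]
  congr 1
  change _ = (b * S * b) (U.onSmooth (-x) w : H)
  generalize U.onSmooth (-x) w = u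
  have hKR : K * R = R * K := by
    rw [hK, hR, ← ProjectionValuedMeasure.integral_mul (measurable_resolventProd.pow_const _)
      (norm_resolventProd_pow_le _) (measurable_damping n) (norm_damping_le n),
      ← ProjectionValuedMeasure.integral_mul (measurable_damping n) (norm_damping_le n)
      (measurable_resolventProd.pow_const _) (norm_resolventProd_pow_le _)]
    simp only [mul_comm]
  have h1 : E.onSmooth (fun p => resolventProd d p ^ (2 * n + 2 * n)) u =
      E.onSmooth (damping d n) (E.onSmooth (fun p => resolventProd d p ^ (2 * n))
        (E.onSmooth (resolventQuotient d n) u)) := Subtype.ext (by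
    simp only [coe_onSmooth]
    rw [E.integral_resolventProd_pow_add]
    change (K * K) (u : H) = R (K (b (u : H)))
    have h2 : K * K = R * (K * b) := by
      rw [← mul_assoc, ← hKR, mul_assoc, hRb]
    rw [h2]
    rfl)
  refine E.integral_damping_injective n ?_
  rw [h1, ← hT0]
  change (T 0 * K) (b (u : H)) = R ((b * S * b) (u : H))
  rw [hTS, ← hRb]
  rfl

end SpectralResolution

/-! ### Mollifiers -/

section Mollify

variable {d : ℕ} {h : EuclideanSpace ℝ (Fin d) → ℝ}

lemma IsMollifier.continuous_mollify (hh : IsMollifier h) (ε : ℝ) :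
    Continuous fun z : EuclideanSpace ℝ (Fin d) × EuclideanSpace ℝ (Fin d) =>
      mollify h ε z.1 z.2 := by
  unfold mollify
  have := hh.contDiff.continuous
  fun_prop

lemma IsMollifier.measurable_mollify (hh : IsMollifier h) (ε : ℝ) (p : EuclideanSpace ℝ (Fin d)) :
    Measurable (mollify h ε p) :=
  ((hh.continuous_mollify ε).comp (Continuous.prodMk_right p)).measurable

lemma IsMollifier.exists_norm_mollify_le (hh : IsMollifier h) (ε : ℝ) :
    ∃ C : ℝ, 0 ≤ C ∧ ∀ p q, ‖mollify h ε p q‖ ≤ C := by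
  obtain ⟨C, hC⟩ := hh.hasCompactSupport.exists_bound_of_continuous hh.contDiff.continuous
  have hC0 : 0 ≤ C := (norm_nonneg _).trans (hC 0)
  refine ⟨‖(ε ^ d)⁻¹‖ * C, by positivity, fun p q => ?_⟩
  rw [mollify, Complex.norm_real, norm_mul]
  exact mul_le_mul_of_nonneg_left (hC _) (norm_nonneg _)

/-- As `h_ε(p - q)` vanishes unless `p - q` is in a bounded set, decay in `q` is decay in `p`. -/
lemma IsMollifier.exists_norm_mollify_mul_le (hh : IsMollifier h) {ε : ℝ} (hε : 0 < ε) (n : ℕ) :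
    ∃ C : ℝ, 0 ≤ C ∧
      ∀ p q, ‖mollify h ε p q‖ * realDamping d n q ≤ C * realDamping d n p := by
  obtain ⟨C, hC0, hC⟩ := hh.exists_norm_mollify_le ε
  obtain ⟨r, hr⟩ := hh.hasCompactSupport.isCompact.isBounded.exists_norm_le
  refine ⟨C * (2 * (1 + (ε * r) ^ 2)) ^ n, by positivity, fun p q => ?_⟩
  by_cases h0 : h (ε⁻¹ • (p - q)) = 0
  · rw [mollify, h0, mul_zero, Complex.ofReal_zero, norm_zero, zero_mul]
    have := (realDamping_pos n p).le
    positivity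
  · have h1 := hr _ (subset_tsupport _ h0)
    rw [norm_smul, norm_inv, Real.norm_of_nonneg hε.le, inv_mul_le_iff₀ hε] at h1
    have h2 := realDamping_le_mul n p q
    rw [mul_assoc]
    refine mul_le_mul (hC p q) (h2.trans ?_) (realDamping_pos n q).le hC0
    have := (realDamping_pos n p).le
    gcongr

end Mollify

/-! ### Integrals of operators between spectral functions -/

namespace ProjectionValuedMeasure

variable {X : Type*} [MeasurableSpace X]
  {H : Type*} [NormedAddCommGroup H] [InnerProductSpace ℂ H]

/-- Strong convergence of a bounded family of operators allows a converging argument. -/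
lemma tendsto_apply_of_strong {ι : Type*} {l : Filter ι} {A : ι → H →L[ℂ] H} {A0 : H →L[ℂ] H}
    {C : ℝ} (hA : ∀ i, ‖A i‖ ≤ C) (h : ∀ v, Tendsto (fun i => A i v) l (𝓝 (A0 v)))
    {v : ι → H} {v0 : H} (hv : Tendsto v l (𝓝 v0)) :
    Tendsto (fun i => A i (v i)) l (𝓝 (A0 v0)) := by
  have h1 : Tendsto (fun i => A i (v i - v0)) l (𝓝 0) := by
    refine squeeze_zero_norm (fun i => (A i).le_of_opNorm_le (hA i) _) ?_
    simpa using (tendsto_iff_norm_sub_tendsto_zero.1 hv).const_mul C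
  simpa using h1.add (h v0)

variable [CompleteSpace H] {E : ProjectionValuedMeasure X H}

/-- Two families of functions on `X`, depending continuously on a parameter `p`, with bounds that
make the operators `∫ f p dE · S · ∫ g p dE` integrable with respect to `p`. -/
structure IsSymbolPair {d : ℕ} {X : Type*} [TopologicalSpace X]
    (f g : EuclideanSpace ℝ (Fin d) → X → ℂ) : Prop where
  continuous_left : Continuous (Function.uncurry f)
  continuous_right : Continuous (Function.uncurry g)
  exists_bound : ∃ (C : ℝ) (c c' : EuclideanSpace ℝ (Fin d) → ℝ),
    (∀ p, 0 ≤ c p ∧ c p ≤ C ∧ 0 ≤ c' p ∧ c' p ≤ C) ∧ Integrable (fun p => c p * c' p) ∧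
    (∀ p x, ‖f p x‖ ≤ c p) ∧ ∀ p x, ‖g p x‖ ≤ c' p

namespace IsSymbolPair

variable {d : ℕ} [TopologicalSpace X]
  {f g f' g' : EuclideanSpace ℝ (Fin d) → X → ℂ}

lemma integral_comp_simpleFunc (hfg : IsSymbolPair f g) (s : SimpleFunc X X)
    (S : H →L[ℂ] H) (w : H) :
    ∫ p, E.integral (fun q => f p (s q)) (S (E.integral (fun q => g p (s q)) w)) =
      ∑ x ∈ s.range, ∑ y ∈ s.range,
        (∫ p, f p x * g p y) • E.proj (s ⁻¹' {x}) (S (E.proj (s ⁻¹' {y}) w)) := by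
  obtain ⟨C, c, c', hc, hi, hf, hg⟩ := hfg.exists_bound
  have hint : ∀ x y, Integrable fun p => f p x * g p y := fun x y => by
    refine hi.mono' (((hfg.continuous_left.comp (Continuous.prodMk_left x)).mul
      (hfg.continuous_right.comp (Continuous.prodMk_left y))).aestronglyMeasurable)
      (Eventually.of_forall fun p => ?_)
    exact (norm_mul_le _ _).trans (mul_le_mul (hf p x) (hg p y) (norm_nonneg _) (hc p).1)
  simp_rw [← integral_smul_const]
  have h1 : ∀ x y, Integrable fun p =>
      (f p x * g p y) • E.proj (s ⁻¹' {x}) (S (E.proj (s ⁻¹' {y}) w)) := fun x y =>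
    (hint x y).smul_const _
  simp_rw [fun x => (integral_finsetSum s.range fun y _ => h1 x y).symm]
  rw [← integral_finsetSum _ fun x _ => integrable_finsetSum _ fun y _ => h1 x y]
  congr 1
  ext p
  rw [(IsIntegral.comp_simpleFunc (E := E) (f p) s).integral_eq,
    (IsIntegral.comp_simpleFunc (E := E) (g p) s).integral_eq]
  simp only [sum_apply, smul_apply, _root_.map_sum, _root_.map_smul, Finset.smul_sum, smul_smul]
  rw [Finset.sum_comm]
  simp only [mul_comm]

variable [OpensMeasurableSpace X]

lemma measurable_left (hfg : IsSymbolPair f g) (p : EuclideanSpace ℝ (Fin d)) : Measurable (f p) :=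
  (hfg.continuous_left.comp (Continuous.prodMk_right p)).measurable

lemma measurable_right (hfg : IsSymbolPair f g) (p : EuclideanSpace ℝ (Fin d)) :
    Measurable (g p) :=
  (hfg.continuous_right.comp (Continuous.prodMk_right p)).measurable

lemma continuous_integral_comp (hfg : IsSymbolPair f g) {s : X → X} (hs : Measurable s)
    (S : H →L[ℂ] H) (w : H) : Continuous fun p =>
      E.integral (fun q => f p (s q)) (S (E.integral (fun q => g p (s q)) w)) := by
  obtain ⟨C, c, c', hc, -, hf, hg⟩ := hfg.exists_bound
  have hC0 : 0 ≤ C := (hc 0).1.trans (hc 0).2.1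
  rw [continuous_iff_continuousAt]
  intro p0
  refine tendsto_apply_of_strong (C := C) (fun p => norm_integral_le
    ((hfg.measurable_left p).comp hs) hC0 fun q => (hf p _).trans (hc p).2.1) (fun v => ?_)
    (S.continuous.continuousAt.tendsto.comp ?_)
  · exact tendsto_integral_apply (fun p => (hfg.measurable_left p).comp hs)
      ((hfg.measurable_left p0).comp hs) (fun p q => (hf p _).trans (hc p).2.1)
      (fun q => (hf p0 _).trans (hc p0).2.1)
      (fun q => (hfg.continuous_left.comp (Continuous.prodMk_left (s q))).continuousAt) v
  · exact tendsto_integral_apply (fun p => (hfg.measurable_right p).comp hs)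
      ((hfg.measurable_right p0).comp hs) (fun p q => (hg p _).trans (hc p).2.2.2)
      (fun q => (hg p0 _).trans (hc p0).2.2.2)
      (fun q => (hfg.continuous_right.comp (Continuous.prodMk_left (s q))).continuousAt) w

/-- The operators `∫ dp (∫ f p dE) S (∫ g p dE)` can be computed by discretizing the spectrum. -/
lemma tendsto_integral_comp (hfg : IsSymbolPair f g) {s : ℕ → X → X}
    (hs : ∀ n, Measurable (s n)) (hlim : ∀ q, Tendsto (fun n => s n q) atTop (𝓝 q))
    (S : H →L[ℂ] H) (w : H) : Tendsto (fun n => ∫ p,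
      E.integral (fun q => f p (s n q)) (S (E.integral (fun q => g p (s n q)) w))) atTop
      (𝓝 (∫ p, E.integral (f p) (S (E.integral (g p) w)))) := by
  obtain ⟨C, c, c', hc, hi, hf, hg⟩ := hfg.exists_bound
  refine tendsto_integral_of_dominated_convergence (fun p => c p * c' p * (‖S‖ * ‖w‖))
    (fun n => (hfg.continuous_integral_comp (hs n) S w).aestronglyMeasurable)
    (hi.mul_const _) (fun n => Eventually.of_forall fun p => ?_) (Eventually.of_forall fun p => ?_)
  · calc _ ≤ c p * ‖S (E.integral (fun q => g p (s n q)) w)‖ :=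
          norm_integral_apply_le ((hfg.measurable_left p).comp (hs n)) (hc p).1 (fun q => hf p _) _
      _ ≤ c p * (‖S‖ * (c' p * ‖w‖)) := by
          refine mul_le_mul_of_nonneg_left ((S.le_opNorm _).trans ?_) (hc p).1
          exact mul_le_mul_of_nonneg_left (norm_integral_apply_le
            ((hfg.measurable_right p).comp (hs n)) (hc p).2.2.1 (fun q => hg p _) _) (norm_nonneg _)
      _ = _ := by ring
  · refine tendsto_apply_of_strong (C := c p) (fun n => norm_integral_le
      ((hfg.measurable_left p).comp (hs n)) (hc p).1 fun q => hf p _) (fun v => ?_)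
      (S.continuous.continuousAt.tendsto.comp ?_)
    · exact tendsto_integral_apply (fun n => (hfg.measurable_left p).comp (hs n))
        (hfg.measurable_left p) (fun n q => hf p _) (fun q => hf p _)
        (fun q => ((hfg.continuous_left.comp
          (Continuous.prodMk_right p)).continuousAt.tendsto.comp (hlim q))) v
    · exact tendsto_integral_apply (fun n => (hfg.measurable_right p).comp (hs n))
        (hfg.measurable_right p) (fun n q => hg p _) (fun q => hg p _)
        (fun q => ((hfg.continuous_right.comp
          (Continuous.prodMk_right p)).continuousAt.tendsto.comp (hlim q))) w

/-- The operator `∫ dp (∫ f p dE) S (∫ g p dE)` only depends on the kernel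
`(x, y) ↦ ∫ f p x * g p y dp`. -/
lemma integral_eq_of_kernel_eq [TopologicalSpace.PseudoMetrizableSpace X] [BorelSpace X]
    [SecondCountableTopology X] (hfg : IsSymbolPair f g) (hfg' : IsSymbolPair f' g')
    (hk : ∀ x y, ∫ p, f p x * g p y = ∫ p, f' p x * g' p y) (S : H →L[ℂ] H) (w : H) :
    ∫ p, E.integral (f p) (S (E.integral (g p) w)) =
      ∫ p, E.integral (f' p) (S (E.integral (g' p) w)) := by
  have hid : StronglyMeasurable (fun q : X => q) := stronglyMeasurable_id
  have h1 := hfg.tendsto_integral_comp (E := E) (fun n => (hid.approx n).measurable)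
    hid.tendsto_approx S w
  have h2 := hfg'.tendsto_integral_comp (E := E) (fun n => (hid.approx n).measurable)
    hid.tendsto_approx S w
  refine tendsto_nhds_unique h1 (h2.congr fun n => ?_)
  rw [hfg.integral_comp_simpleFunc, hfg'.integral_comp_simpleFunc]
  simp only [hk]

end IsSymbolPair

end ProjectionValuedMeasure

/-! ### Regularized left and right integrals -/

namespace SpectralResolution

variable {H : Type*} [NormedAddCommGroup H] [InnerProductSpace ℂ H] [CompleteSpace H] {d : ℕ}
  {B : LinearMap.BilinForm ℝ (EuclideanSpace ℝ (Fin d))} {U : TranslationRep d H}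
  (E : SpectralResolution B U) {h : EuclideanSpace ℝ (Fin d) → ℝ}

lemma continuous_integral_mollify (hh : IsMollifier h) {ε : ℝ} (hε : 0 < ε) :
    Continuous fun p => E.integral (mollify h ε p) := by
  have huc : UniformContinuous h :=
    hh.hasCompactSupport.uniformContinuous_of_continuous hh.contDiff.continuous
  obtain ⟨C, hC0, hC⟩ := hh.exists_norm_mollify_le ε
  rw [Metric.continuous_iff]
  intro p0 δ hδ
  obtain ⟨η, hη, hu⟩ := Metric.uniformContinuous_iff.1 huc (ε ^ d * (δ / 2)) (by positivity)
  refine ⟨ε * η, by positivity, fun p hp => ?_⟩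
  have hm := fun p => hh.measurable_mollify ε p
  rw [dist_eq_norm, ← ProjectionValuedMeasure.integral_sub_eq (hm p) (hC p) (hm p0) (hC p0)]
  refine lt_of_le_of_lt (ProjectionValuedMeasure.norm_integral_le
    (f := fun q => mollify h ε p q - mollify h ε p0 q) ((hm p).sub (hm p0))
    (C := δ / 2) (by positivity) fun q => ?_) (by linarith)
  simp only [mollify]
  rw [← Complex.ofReal_sub, Complex.norm_real, ← mul_sub, norm_mul, norm_inv,
    Real.norm_of_nonneg (by positivity : 0 ≤ ε ^ d), inv_mul_le_iff₀ (by positivity),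
    ← dist_eq_norm]
  refine (hu ?_).le
  rw [dist_eq_norm, ← smul_sub, sub_sub_sub_cancel_right, norm_smul, norm_inv,
    Real.norm_of_nonneg hε.le, inv_mul_lt_iff₀ hε, ← dist_eq_norm]
  exact hp

/-- The operators `E_{h,ε}(p) g(P)` decay in `p` like `g` does. -/
lemma exists_norm_integral_mollify_mul_le (hh : IsMollifier h) {ε : ℝ} (hε : 0 < ε) {n : ℕ}
    {g : EuclideanSpace ℝ (Fin d) → ℂ} (hg : Measurable g) (hgn : ∀ q, ‖g q‖ ≤ realDamping d n q) :
    ∃ C : ℝ, 0 ≤ C ∧ ∀ p, ‖E.integral (mollify h ε p) * E.integral g‖ ≤ C * realDamping d n p := by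
  obtain ⟨C, hC0, hC⟩ := hh.exists_norm_mollify_mul_le hε n
  obtain ⟨C', -, hC'⟩ := hh.exists_norm_mollify_le ε
  refine ⟨C, hC0, fun p => ?_⟩
  rw [← ProjectionValuedMeasure.integral_mul (hh.measurable_mollify ε p) (hC' p) hg
    (C' := 1) fun q => (hgn q).trans (realDamping_le_one n q)]
  refine ProjectionValuedMeasure.norm_integral_le (f := fun q => mollify h ε p q * g q)
    ((hh.measurable_mollify ε p).mul hg)
    (mul_nonneg hC0 (realDamping_pos n p).le) fun q => ?_
  rw [norm_mul]
  exact (mul_le_mul_of_nonneg_left (hgn q) (norm_nonneg _)).trans (hC p q)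

/-- Operators of the form `∫ f dE` commute. -/
lemma integral_mul_comm {f g : EuclideanSpace ℝ (Fin d) → ℂ} (hf : Measurable f) {C : ℝ}
    (hC : ∀ p, ‖f p‖ ≤ C) (hg : Measurable g) {C' : ℝ} (hC' : ∀ p, ‖g p‖ ≤ C') :
    E.integral f * E.integral g = E.integral g * E.integral f := by
  rw [← ProjectionValuedMeasure.integral_mul hf hC hg hC',
    ← ProjectionValuedMeasure.integral_mul hg hC' hf hC]
  simp only [mul_comm]

variable (Q : Matrix (Fin d) (Fin d) ℝ)

lemma continuous_toEuclideanLin : Continuous fun p => Matrix.toEuclideanLin Q p :=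
  (Matrix.toEuclideanLin Q).continuous_of_finiteDimensional

/-- Decay of the left integrand comes from `w` being in the range of a damping operator. -/
lemma integrable_left (hB : B.IsSymm) (hB' : B.Nondegenerate) {S : H →L[ℂ] H}
    (hS : U.IsSmoothOp S) (hh : IsMollifier h) {ε : ℝ} (hε : 0 < ε) {w : H}
    (hw : w ∈ U.smoothVectors) :
    Integrable fun p => U.conj (Matrix.toEuclideanLin Q p) S (E.integral (mollify h ε p) w) := by
  obtain ⟨w', -, rfl⟩ := E.exists_damping_eq hB hB' (d + 1) hw
  obtain ⟨C, hC0, hC⟩ := E.exists_norm_integral_mollify_mul_le hh hε (measurable_damping (d + 1))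
    fun q => (norm_damping _ q).le
  refine (((integrable_realDamping (Nat.lt_succ_self d)).const_mul C).mul_const
    (‖w'‖)).const_mul ‖S‖ |>.mono' ?_ (Eventually.of_forall fun p => ?_)
  · exact ((hS.continuous.comp (continuous_toEuclideanLin Q)).clm_apply
      ((E.continuous_integral_mollify hh hε).clm_apply continuous_const)).aestronglyMeasurable
  · refine (ContinuousLinearMap.le_of_opNorm_le _ (U.norm_conj_apply_le _ S) _).trans ?_
    refine mul_le_mul_of_nonneg_left ?_ (norm_nonneg _)
    exact ContinuousLinearMap.le_of_opNorm_le _ (hC p) w'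

/-- Decay of the right integrand: `w = rᴹ w'`, and `rᴹ` can be moved to the left of `S`. -/
lemma integrable_right (hB : B.IsSymm) (hB' : B.Nondegenerate) {S : H →L[ℂ] H}
    (hS : U.IsSmoothOp S) (hh : IsMollifier h) {ε : ℝ} (hε : 0 < ε) {w : H}
    (hw : w ∈ U.smoothVectors) :
    Integrable fun p => E.integral (mollify h ε p) (U.conj (Matrix.toEuclideanLin Q p) S w) := by
  have hK := E.isRegularizer_resolventProd_pow hB hB' (2 * (d + 1))
  obtain ⟨w', -, rfl⟩ := hK.exists_apply_eq w hw
  obtain ⟨S', hS', hSK⟩ := hK.exists_mul_eq S hS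
  obtain ⟨C, hC0, hC⟩ := E.exists_norm_integral_mollify_mul_le hh hε
    (measurable_resolventProd.pow_const (2 * (d + 1)))
    (norm_resolventProd_pow_le_realDamping (d + 1))
  refine (((integrable_realDamping (Nat.lt_succ_self d)).const_mul C).mul_const
    (‖S'‖ * ‖w'‖)).mono' ?_ (Eventually.of_forall fun p => ?_)
  · exact ((E.continuous_integral_mollify hh hε).clm_apply
      ((hS.continuous.comp (continuous_toEuclideanLin Q)).clm_apply
        continuous_const)).aestronglyMeasurable
  · set K := E.integral fun p => resolventProd d p ^ (2 * (d + 1))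
    generalize Matrix.toEuclideanLin Q p = x
    have h1 : U.conj x S (K w') = K (U.conj x S' w') := by
      rw [TranslationRep.conj_apply, TranslationRep.conj_apply, hK.comm (-x), ← hK.comm x]
      exact congrArg (fun T : H →L[ℂ] H => U x (T (U (-x) w'))) hSK
    rw [h1]
    refine (ContinuousLinearMap.le_of_opNorm_le _ (hC p) _).trans ?_
    refine mul_le_mul_of_nonneg_left ?_ (mul_nonneg hC0 (realDamping_pos _ p).le)
    exact ContinuousLinearMap.le_of_opNorm_le _ (U.norm_conj_apply_le x S') w'

/-- The functions in the regularized left integral, whose kernel between the spectral values `x`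
and `y` is `∫ exp(i B(x - y, Qp)) h_ε(p - y) dp` up to damping factors. -/
lemma isSymbolPair_left (hh : IsMollifier h) {ε : ℝ} (hε : 0 < ε) :
    ProjectionValuedMeasure.IsSymbolPair
      (fun p q => damping d (d + 1) q * phase B (Matrix.toEuclideanLin Q p) q)
      (fun p q => phase B (-Matrix.toEuclideanLin Q p) q *
        (mollify h ε p q * damping d (d + 1) q)) := by
  obtain ⟨C, hC0, hC⟩ := hh.exists_norm_mollify_mul_le hε (d + 1)
  have hQ := continuous_toEuclideanLin Q
  refine ⟨?_, ?_, C + 1, fun _ => 1, fun p => C * realDamping d (d + 1) p, fun p =>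
    ⟨zero_le_one, by linarith, mul_nonneg hC0 (realDamping_pos _ p).le, ?_⟩, ?_, fun p q => ?_,
    fun p q => ?_⟩
  · exact ((continuous_damping _).comp continuous_snd).mul
      (continuous_phase.comp ((hQ.comp continuous_fst).prodMk continuous_snd))
  · exact (continuous_phase.comp ((hQ.comp continuous_fst).neg.prodMk continuous_snd)).mul
      ((hh.continuous_mollify ε).mul ((continuous_damping _).comp continuous_snd))
  · linarith [mul_le_mul_of_nonneg_left (realDamping_le_one (d + 1) p) hC0]
  · simpa only [one_mul] using (integrable_realDamping (Nat.lt_succ_self d)).const_mul C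
  · rw [norm_mul, norm_phase, mul_one]
    exact norm_damping_le _ q
  · rw [norm_mul, norm_mul, norm_phase, one_mul, norm_damping]
    exact hC p q

/-- The functions in the regularized right integral; here `h_ε` sits at the left spectral value. -/
lemma isSymbolPair_right (hh : IsMollifier h) {ε : ℝ} (hε : 0 < ε) :
    ProjectionValuedMeasure.IsSymbolPair
      (fun p q => damping d (d + 1) q * mollify h ε p q * phase B (Matrix.toEuclideanLin Q p) q)
      (fun p q => phase B (-Matrix.toEuclideanLin Q p) q * damping d (d + 1) q) := by
  obtain ⟨C, hC0, hC⟩ := hh.exists_norm_mollify_mul_le hε (d + 1)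
  have hQ := continuous_toEuclideanLin Q
  refine ⟨?_, ?_, C + 1, fun p => C * realDamping d (d + 1) p, fun _ => 1, fun p =>
    ⟨mul_nonneg hC0 (realDamping_pos _ p).le, ?_, zero_le_one, by linarith⟩, ?_, fun p q => ?_,
    fun p q => ?_⟩
  · exact (((continuous_damping _).comp continuous_snd).mul (hh.continuous_mollify ε)).mul
      (continuous_phase.comp ((hQ.comp continuous_fst).prodMk continuous_snd))
  · exact (continuous_phase.comp ((hQ.comp continuous_fst).neg.prodMk continuous_snd)).mul
      ((continuous_damping _).comp continuous_snd)
  · linarith [mul_le_mul_of_nonneg_left (realDamping_le_one (d + 1) p) hC0]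
  · simpa only [mul_one] using (integrable_realDamping (Nat.lt_succ_self d)).const_mul C
  · rw [norm_mul, norm_mul, norm_phase, mul_one, norm_damping, mul_comm]
    exact hC p q
  · rw [norm_mul, norm_phase, one_mul]
    exact norm_damping_le _ q

variable {Q} in
/-- Left and right integral have the same kernel: both are translates of one integral, as
`B(x - y, Q(x - y)) = 0`. -/
lemma kernel_eq (hQ : ∀ p q : EuclideanSpace ℝ (Fin d),
      B q (Matrix.toEuclideanLin Q p) = -B p (Matrix.toEuclideanLin Q q))
    (ε : ℝ) (x y : EuclideanSpace ℝ (Fin d)) :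
    ∫ p, damping d (d + 1) x * phase B (Matrix.toEuclideanLin Q p) x *
        (phase B (-Matrix.toEuclideanLin Q p) y * (mollify h ε p y * damping d (d + 1) y)) =
      ∫ p, damping d (d + 1) x * mollify h ε p x * phase B (Matrix.toEuclideanLin Q p) x *
        (phase B (-Matrix.toEuclideanLin Q p) y * damping d (d + 1) y) := by
  have hself : ∀ p, B p (Matrix.toEuclideanLin Q p) = 0 := fun p => by linarith [hQ p p]
  rw [← integral_add_right_eq_self _ y]
  conv_rhs => rw [← integral_add_right_eq_self _ x]
  congr 1
  ext p
  have h1 : mollify h ε (p + y) y = mollify h ε (p + x) x := by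
    simp only [mollify, add_sub_cancel_right]
  have h2 : phase B (Matrix.toEuclideanLin Q (p + y)) x *
      phase B (-Matrix.toEuclideanLin Q (p + y)) y =
      phase B (Matrix.toEuclideanLin Q (p + x)) x *
        phase B (-Matrix.toEuclideanLin Q (p + x)) y := by
    simp only [phase, ← Complex.exp_add, ← mul_add, ← Complex.ofReal_add, _root_.map_add,
      _root_.map_neg, hself, hQ x y]
    congr 3
    ring
  rw [h1]
  linear_combination damping d (d + 1) x * damping d (d + 1) y * mollify h ε (p + x) x * h2

variable {Q} in
/-- For a skew-symmetric matrix, the regularized left and right integrals coincide. -/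
lemma integral_left_eq_right (hB : B.IsSymm) (hB' : B.Nondegenerate)
    (hQ : ∀ p q : EuclideanSpace ℝ (Fin d),
      B q (Matrix.toEuclideanLin Q p) = -B p (Matrix.toEuclideanLin Q q)) {S : H →L[ℂ] H}
    (hS : U.IsSmoothOp S) (hh : IsMollifier h) {ε : ℝ} (hε : 0 < ε) {w : H}
    (hw : w ∈ U.smoothVectors) :
    ∫ p, U.conj (Matrix.toEuclideanLin Q p) S (E.integral (mollify h ε p) w) =
      ∫ p, E.integral (mollify h ε p) (U.conj (Matrix.toEuclideanLin Q p) S w) := by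
  have hl := E.integrable_left Q hB hB' hS hh hε hw
  have hr := E.integrable_right Q hB hB' hS hh hε hw
  obtain ⟨w', -, rfl⟩ := E.exists_damping_eq hB hB' (d + 1) hw
  obtain ⟨C, -, hC⟩ := hh.exists_norm_mollify_le ε
  have hm := hh.measurable_mollify ε
  have hphase : ∀ x q, ‖phase B x q‖ ≤ 1 := fun x q => (norm_phase x q).le
  have hD := measurable_damping (d := d) (d + 1)
  have hD1 := norm_damping_le (d := d) (d + 1)
  -- it suffices to compare after damping from the left, where the integrands have kernels
  refine E.integral_damping_injective (d + 1) ?_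
  rw [← ContinuousLinearMap.integral_comp_comm _ hl, ← ContinuousLinearMap.integral_comp_comm _ hr]
  refine Eq.trans ?_ (((isSymbolPair_left (B := B) Q hh hε).integral_eq_of_kernel_eq
    (isSymbolPair_right (B := B) Q hh hε) (kernel_eq hQ ε) (E := E.toProjectionValuedMeasure)
    S w').trans ?_)
  · congr 1
    ext p
    rw [ProjectionValuedMeasure.integral_mul hD hD1 (measurable_phase _) (hphase _),
      ProjectionValuedMeasure.integral_mul (measurable_phase _) (hphase _)
        (g := fun q => mollify h ε p q * damping d (d + 1) q) ((hm p).mul hD)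
        (C' := C * 1) (fun q => by
          rw [norm_mul]
          exact mul_le_mul (hC p q) (hD1 q) (norm_nonneg _) ((norm_nonneg _).trans (hC p q))),
      ProjectionValuedMeasure.integral_mul (hm p) (hC p) hD hD1, E.integral_phase,
      E.integral_phase]
    rfl
  · congr 1
    ext p
    rw [ProjectionValuedMeasure.integral_mul
        (f := fun q => damping d (d + 1) q * mollify h ε p q) (hD.mul (hm p))
        (C := 1 * C) (fun q => by
          rw [norm_mul]
          exact mul_le_mul (hD1 q) (hC p q) (norm_nonneg _) zero_le_one)
          (measurable_phase _) (hphase _),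
      ProjectionValuedMeasure.integral_mul hD hD1 (hm p) (hC p),
      ProjectionValuedMeasure.integral_mul (measurable_phase _) (hphase _) hD hD1,
      E.integral_phase, E.integral_phase]
    rfl

end SpectralResolution

/-! ### Fourier representation of functions with bounded derivatives -/

section Fourier

open scoped FourierTransform

variable {d : ℕ}

lemma realDamping_anti {m n : ℕ} (hmn : m ≤ n) (p : EuclideanSpace ℝ (Fin d)) :
    realDamping d n p ≤ realDamping d m p := by
  obtain ⟨k, rfl⟩ := Nat.exists_eq_add_of_le hmn
  rw [realDamping_add]
  exact mul_le_of_le_one_right (realDamping_pos m p).le (realDamping_le_one k p)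

lemma contDiff_realDamping (n : ℕ) : ContDiff ℝ ∞ (realDamping d n) := by
  unfold realDamping
  exact ContDiff.inv ((contDiff_const.add (contDiff_norm_sq ℝ)).pow n) fun p => by positivity

/-- Each derivative of `(1 + |p|²)⁻ᵐ` costs at most a factor `(1 + |p|²)ᵏ`, with `k` not depending
on `m`. -/
lemma exists_norm_iteratedFDeriv_realDamping_mul_le (d N : ℕ) : ∃ k : ℕ, ∀ m : ℕ, ∃ C : ℝ,
    0 ≤ C ∧ ∀ n ≤ N, ∀ p, ‖iteratedFDeriv ℝ n (realDamping d m) p‖ * realDamping d (k * n) p ≤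
      C * realDamping d m p := by
  have ht : (realDamping d 1).HasTemperateGrowth := by
    have h := Function.hasTemperateGrowth_one_add_norm_sq_rpow (EuclideanSpace ℝ (Fin d)) (-1)
    have h1 : realDamping d 1 = fun p => (1 + ‖p‖ ^ 2) ^ (-1 : ℝ) := by
      funext p
      rw [realDamping, pow_one, Real.rpow_neg_one]
    rwa [h1]
  -- the case `m = 1` holds by temperate growth, and products follow from the Leibniz rule
  obtain ⟨k, C, hC0, hC⟩ := ht.norm_iteratedFDeriv_le_uniform N
  have h1 : ∀ n ≤ N, ∀ p, ‖iteratedFDeriv ℝ n (realDamping d 1) p‖ * realDamping d ((k + 1) * n) p ≤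
      (C * 2 ^ k + 1) * realDamping d 1 p := by
    intro n hn p
    have hp := realDamping_pos (d := d) 1 p
    rcases Nat.eq_zero_or_pos n with rfl | hn0
    · rw [norm_iteratedFDeriv_zero, mul_zero, Real.norm_of_nonneg hp.le]
      have h0 : realDamping d 0 p = 1 := by simp [realDamping]
      rw [h0, mul_one]
      nlinarith [mul_nonneg (mul_nonneg hC0 (pow_nonneg (zero_le_two (α := ℝ)) k)) hp.le]
    · have h2 : realDamping d ((k + 1) * n) p ≤ realDamping d k p * realDamping d 1 p := by
        rw [← realDamping_add]
        exact realDamping_anti (Nat.le_mul_of_pos_right _ hn0) p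
      have h3 : (1 + ‖p‖) ^ k * realDamping d k p ≤ 2 ^ k := by
        rw [realDamping, ← div_eq_mul_inv, div_le_iff₀ (by positivity), ← mul_pow]
        exact pow_le_pow_left₀ (by positivity) (by nlinarith [sq_nonneg (‖p‖ - 1)]) k
      calc _ ≤ (C * (1 + ‖p‖) ^ k) * (realDamping d k p * realDamping d 1 p) :=
            mul_le_mul (hC n hn p) h2 (realDamping_pos _ p).le (by positivity)
        _ = C * ((1 + ‖p‖) ^ k * realDamping d k p) * realDamping d 1 p := by ring
        _ ≤ C * 2 ^ k * realDamping d 1 p := by gcongr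
        _ ≤ _ := by gcongr; linarith
  refine ⟨k + 1, fun m => ?_⟩
  induction m with
  | zero =>
    refine ⟨1, zero_le_one, fun n _ p => ?_⟩
    have h0 : realDamping d 0 = fun _ => 1 := by ext p; simp [realDamping]
    rw [h0]
    rcases Nat.eq_zero_or_pos n with rfl | hn0
    · rw [norm_iteratedFDeriv_zero]
      simp [h0]
    · rw [iteratedFDeriv_const_of_ne hn0.ne']
      simp
  | succ m ih =>
    obtain ⟨C', hC'0, hC'⟩ := ih
    set C1 := C * 2 ^ k + 1
    have hC1 : 0 ≤ C1 := by positivity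
    refine ⟨2 ^ N * (C' * C1), by positivity, fun n hn p => ?_⟩
    have hprod : realDamping d (m + 1) = fun p => realDamping d m p * realDamping d 1 p :=
      funext fun p => realDamping_add m 1 p
    have hL := norm_iteratedFDeriv_mul_le (contDiff_realDamping (d := d) m)
      (contDiff_realDamping (d := d) 1) p (n := n) (by exact_mod_cast le_top)
    rw [hprod]
    have hpos := fun j => realDamping_pos (d := d) j p
    refine (mul_le_mul_of_nonneg_right hL (hpos _).le).trans ?_
    rw [Finset.sum_mul]
    have hterm : ∀ i ∈ Finset.range (n + 1),
        (n.choose i : ℝ) * ‖iteratedFDeriv ℝ i (realDamping d m) p‖ *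
          ‖iteratedFDeriv ℝ (n - i) (realDamping d 1) p‖ * realDamping d ((k + 1) * n) p ≤
        (n.choose i : ℝ) * ((C' * C1) * (realDamping d m p * realDamping d 1 p)) := by
      intro i hi
      have hin : i ≤ n := Nat.lt_succ_iff.1 (Finset.mem_range.1 hi)
      have hsplit : realDamping d ((k + 1) * n) p =
          realDamping d ((k + 1) * i) p * realDamping d ((k + 1) * (n - i)) p := by
        rw [← realDamping_add, ← mul_add, Nat.add_sub_cancel' hin]
      have := mul_le_mul (hC' i (hin.trans hn) p) (h1 (n - i) ((Nat.sub_le _ _).trans hn) p)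
        (mul_nonneg (norm_nonneg _) (hpos _).le) (mul_nonneg hC'0 (hpos _).le)
      rw [hsplit]
      calc _ = (n.choose i : ℝ) * ((‖iteratedFDeriv ℝ i (realDamping d m) p‖ *
              realDamping d ((k + 1) * i) p) *
            (‖iteratedFDeriv ℝ (n - i) (realDamping d 1) p‖ *
              realDamping d ((k + 1) * (n - i)) p)) := by ring
        _ ≤ (n.choose i : ℝ) * ((C' * realDamping d m p) * (C1 * realDamping d 1 p)) :=
            mul_le_mul_of_nonneg_left this (Nat.cast_nonneg _)
        _ = _ := by ring
    refine (Finset.sum_le_sum hterm).trans ?_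
    rw [← Finset.sum_mul]
    have hchoose : (∑ i ∈ Finset.range (n + 1), (n.choose i : ℝ)) = 2 ^ n := by
      exact_mod_cast Nat.sum_range_choose n
    have h2n : (2 : ℝ) ^ n ≤ 2 ^ N := pow_le_pow_right₀ one_le_two hn
    rw [hchoose, mul_assoc (2 ^ N : ℝ)]
    have := mul_nonneg (mul_nonneg hC'0 hC1) (mul_nonneg (hpos m).le (hpos 1).le)
    exact mul_le_mul_of_nonneg_right h2n this

/-- For large `K`, the first `N` derivatives of `(1 + |p|²)⁻ᴷ` are bounded by a multiple of
`(1 + |p|²)⁻ᵐ`. -/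
lemma exists_norm_iteratedFDeriv_realDamping_le (d N m : ℕ) : ∃ (K : ℕ) (C : ℝ), 0 ≤ C ∧
    ∀ n ≤ N, ∀ p, ‖iteratedFDeriv ℝ n (realDamping d K) p‖ ≤ C * realDamping d m p := by
  obtain ⟨k, hk⟩ := exists_norm_iteratedFDeriv_realDamping_mul_le d N
  obtain ⟨C, hC0, hC⟩ := hk (m + k * N)
  refine ⟨m + k * N, C, hC0, fun n hn p => ?_⟩
  have h1 := hC n hn p
  rw [realDamping_add] at h1
  have hp := realDamping_pos (d := d) (k * n) p
  refine le_of_mul_le_mul_right (h1.trans ?_) hp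
  rw [mul_assoc]
  have h2 := realDamping_anti (Nat.mul_le_mul_left k hn) p
  gcongr
  exact (realDamping_pos m p).le

variable {W : Type*} [NormedAddCommGroup W] [NormedSpace ℂ W]

/-- The character `p ↦ exp(2πi ⟨x, p⟩)` of Fourier theory. -/
def fourierPhase (x p : EuclideanSpace ℝ (Fin d)) : ℂ := (Real.fourierChar ⟪x, p⟫_ℝ : Circle)

lemma norm_fourierPhase (x p : EuclideanSpace ℝ (Fin d)) : ‖fourierPhase x p‖ = 1 :=
  Circle.norm_coe _

lemma continuous_fourierPhase :
    Continuous fun z : EuclideanSpace ℝ (Fin d) × EuclideanSpace ℝ (Fin d) =>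
      fourierPhase z.1 z.2 :=
  continuous_subtype_val.comp (Real.continuous_fourierChar.comp continuous_inner)

/-- A function with bounded derivatives is a polynomial weight times the Fourier transform of an
integrable function. -/
lemma exists_fourier_representation [CompleteSpace W] {f : EuclideanSpace ℝ (Fin d) → W}
    (hf : ContDiff ℝ ∞ f) (hb : ∀ n : ℕ, ∃ C : ℝ, ∀ p, ‖iteratedFDeriv ℝ n f p‖ ≤ C) :
    ∃ (K : ℕ) (g : EuclideanSpace ℝ (Fin d) → W), Continuous g ∧ Integrable g ∧
      ∀ p, f p = ∫ x, (fourierPhase x p * (damping d K p)⁻¹) • g x := by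
  -- the Fourier transform is integrable if `‖x‖ ^ N` times it is bounded; hence `N` derivatives of
  -- the damped function `F` have to be integrable
  set N := (volume : Measure (EuclideanSpace ℝ (Fin d))).integrablePower
  obtain ⟨K, C, hC0, hC⟩ := exists_norm_iteratedFDeriv_realDamping_le d N (d + 1)
  choose C' hC' using hb
  let F : EuclideanSpace ℝ (Fin d) → W := fun p => realDamping d K p • f p
  have hF : ContDiff ℝ ∞ F := (contDiff_realDamping K).smul hf
  have hint : ∀ n ≤ N, Integrable fun p => ‖iteratedFDeriv ℝ n F p‖ := by
    intro n hn
    refine ((integrable_realDamping (Nat.lt_succ_self d)).const_mul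
      (∑ i ∈ Finset.range (n + 1), (n.choose i : ℝ) * C * C' (n - i))).mono'
      ((hF.continuous_iteratedFDeriv (m := n) (by exact_mod_cast le_top)).norm.aestronglyMeasurable)
      (Eventually.of_forall fun p => ?_)
    rw [norm_norm]
    refine (norm_iteratedFDeriv_smul_le (contDiff_realDamping K) hf p (n := n)
      (by exact_mod_cast le_top)).trans ?_
    rw [Finset.sum_mul]
    refine Finset.sum_le_sum fun i hi => ?_
    have hin : i ≤ n := Nat.lt_succ_iff.1 (Finset.mem_range.1 hi)
    calc _ ≤ (n.choose i : ℝ) * (C * realDamping d (d + 1) p) * C' (n - i) := by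
          have := (realDamping_pos (d := d) (d + 1) p).le
          gcongr
          · exact hC i (hin.trans hn) p
          · exact hC' _ p
      _ = _ := by ring
  have hFi : Integrable F := by
    have h0 := hint 0 (Nat.zero_le _)
    simp only [norm_iteratedFDeriv_zero] at h0
    exact (integrable_norm_iff hF.continuous.aestronglyMeasurable).1 h0
  have hcont : Continuous (𝓕 F) :=
    VectorFourier.fourierIntegral_continuous Real.continuous_fourierChar
      (L := innerₗ (EuclideanSpace ℝ (Fin d))) continuous_inner hFi
  have hdecay : ∀ n ≤ N, ∃ D : ℝ, ∀ x, ‖x‖ ^ n * ‖𝓕 F x‖ ≤ D := by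
    intro n hn
    have h := Real.pow_mul_norm_iteratedFDeriv_fourier_le (K := 0) (N := N) (f := F) (k := 0)
      (n := n) (hF.of_le (by exact_mod_cast le_top)) (fun k m hk hm => by
        obtain rfl : k = 0 := by simpa using hk
        simpa using hint m (by exact_mod_cast hm)) le_rfl (by exact_mod_cast hn)
    simp only [norm_iteratedFDeriv_zero] at h
    exact ⟨_, h⟩
  have hFFi : Integrable (𝓕 F) := by
    obtain ⟨D, hD⟩ := hdecay 0 (Nat.zero_le _)
    obtain ⟨D', hD'⟩ := hdecay N le_rfl
    have := integrable_of_le_of_pow_mul_le (μ := volume) (k := 0) (fun x => by simpa using hD x)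
      (fun x => by simpa only [zero_add] using hD' x) hcont.aestronglyMeasurable
    simp only [pow_zero, one_mul] at this
    exact (integrable_norm_iff hcont.aestronglyMeasurable).1 this
  refine ⟨K, 𝓕 F, hcont, hFFi, fun p => ?_⟩
  have hinv := congrFun (hF.continuous.fourierInv_fourier_eq hFi hFFi) p
  rw [Real.fourierInv_eq] at hinv
  simp_rw [mul_comm (fourierPhase _ p), mul_smul]
  rw [integral_smul]
  have h2 : ∫ x, fourierPhase x p • 𝓕 F x = F p := hinv
  rw [h2, eq_inv_smul_iff₀ (damping_ne_zero K p), damping_eq_ofReal, Complex.coe_smul]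

end Fourier

/-! ### The limit of the regularized integrals -/

section Symbols

variable {d : ℕ} {h : EuclideanSpace ℝ (Fin d) → ℝ}

/-- The spectral function by which a Fourier mode `x` enters the regularized left integral at the
point `p`, when the smooth operator has weight `(1 + |p|²)ᴷ` and the vector is damped. -/
def modeSymbol (h : EuclideanSpace ℝ (Fin d) → ℝ) (ε : ℝ) (K : ℕ)
    (x p q : EuclideanSpace ℝ (Fin d)) : ℂ :=
  fourierPhase x p * (damping d K p)⁻¹ * (mollify h ε p q * damping d (K + (d + 1)) q)

lemma IsMollifier.measurable_modeSymbol (hh : IsMollifier h) (ε : ℝ) (K : ℕ)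
    (x : EuclideanSpace ℝ (Fin d)) : Measurable (Function.uncurry (modeSymbol h ε K x)) :=
  ((continuous_fourierPhase.comp (continuous_const.prodMk continuous_fst)).measurable.mul
    ((measurable_damping K).comp measurable_fst).inv).mul
    ((hh.continuous_mollify ε).measurable.mul ((measurable_damping _).comp measurable_snd))

lemma IsMollifier.exists_norm_modeSymbol_le (hh : IsMollifier h) {ε : ℝ} (hε : 0 < ε) (K : ℕ) :
    ∃ C : ℝ, 0 ≤ C ∧ ∀ x p q, ‖modeSymbol h ε K x p q‖ ≤ C * realDamping d (d + 1) p := by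
  obtain ⟨C, hC0, hC⟩ := hh.exists_norm_mollify_mul_le hε (K + (d + 1))
  refine ⟨C, hC0, fun x p q => ?_⟩
  have hK := realDamping_pos (d := d) K p
  rw [modeSymbol, norm_mul, norm_mul, norm_mul, norm_fourierPhase, one_mul, norm_inv, norm_damping,
    norm_damping, inv_mul_le_iff₀ hK]
  refine (hC p q).trans (le_of_eq ?_)
  rw [realDamping_add]
  ring

/-- The substitution `p = q + ε s`. -/
lemma integral_modeSymbol_eq {ε : ℝ} (hε : 0 < ε) (K : ℕ) (x q : EuclideanSpace ℝ (Fin d)) :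
    ∫ p, modeSymbol h ε K x p q = ∫ s, damping d (K + (d + 1)) q *
      (fourierPhase x (ε • s + q) * (damping d K (ε • s + q))⁻¹ * (h s : ℂ)) := by
  have hεd : (0 : ℝ) < ε ^ d := by positivity
  rw [← integral_add_right_eq_self _ q]
  have h1 := Measure.integral_comp_smul_of_nonneg (μ := volume)
    (fun p => modeSymbol h ε K x (p + q) q) ε (hR := hε.le)
  rw [finrank_euclideanSpace_fin, eq_inv_smul_iff₀ hεd.ne', ← integral_smul] at h1
  rw [← h1]
  congr 1
  ext s
  rw [modeSymbol, mollify, add_sub_cancel_right, smul_smul, inv_mul_cancel₀ hε.ne', one_smul,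
    Complex.real_smul]
  push_cast
  have : (ε : ℂ) ^ d ≠ 0 := pow_ne_zero _ (Complex.ofReal_ne_zero.2 hε.ne')
  field_simp

/-- A bound on the integrand after the substitution `p = q + ε s`, uniform in `ε ≤ 1`. -/
lemma norm_modeSymbol_substituted_le {ε : ℝ} (hε : 0 < ε) (hε1 : ε ≤ 1) (K : ℕ)
    (x q s : EuclideanSpace ℝ (Fin d)) :
    ‖damping d (K + (d + 1)) q *
      (fourierPhase x (ε • s + q) * (damping d K (ε • s + q))⁻¹ * (h s : ℂ))‖ ≤
      (2 * (1 + ‖s‖ ^ 2)) ^ K * ‖h s‖ := by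
  rw [norm_mul, norm_mul, norm_mul, norm_fourierPhase, one_mul, norm_inv, norm_damping,
    norm_damping, Complex.norm_real, ← mul_assoc]
  refine mul_le_mul_of_nonneg_right ?_ (norm_nonneg _)
  rw [mul_inv_le_iff₀ (realDamping_pos _ _)]
  refine (realDamping_anti (Nat.le_add_right _ _) q).trans
    ((realDamping_le_mul K (ε • s + q) q).trans ?_)
  refine mul_le_mul_of_nonneg_right ?_ (realDamping_pos _ _).le
  have h1 : ‖ε • s + q - q‖ ≤ ‖s‖ := by
    rw [add_sub_cancel_right, norm_smul, Real.norm_of_nonneg hε.le]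
    exact mul_le_of_le_one_left (norm_nonneg _) hε1
  gcongr

lemma IsMollifier.integrable_weight (hh : IsMollifier h) (K : ℕ) :
    Integrable fun s : EuclideanSpace ℝ (Fin d) => (2 * (1 + ‖s‖ ^ 2)) ^ K * ‖h s‖ := by
  refine Continuous.integrable_of_hasCompactSupport ?_ hh.hasCompactSupport.norm.mul_left
  have := hh.contDiff.continuous
  fun_prop

lemma IsMollifier.norm_integral_modeSymbol_le (hh : IsMollifier h) {ε : ℝ} (hε : 0 < ε)
    (hε1 : ε ≤ 1) (K : ℕ) (x q : EuclideanSpace ℝ (Fin d)) :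
    ‖∫ p, modeSymbol h ε K x p q‖ ≤ ∫ s : EuclideanSpace ℝ (Fin d),
      (2 * (1 + ‖s‖ ^ 2)) ^ K * ‖h s‖ := by
  rw [integral_modeSymbol_eq hε]
  exact norm_integral_le_of_norm_le (hh.integrable_weight K)
    (Eventually.of_forall (norm_modeSymbol_substituted_le hε hε1 K x q))

/-- As `ε` tends to `0`, the mollifier evaluates the mode at `p = q`. -/
lemma IsMollifier.tendsto_integral_modeSymbol (hh : IsMollifier h) (K : ℕ)
    (x q : EuclideanSpace ℝ (Fin d)) :
    Tendsto (fun ε => ∫ p, modeSymbol h ε K x p q) (𝓝[>] 0)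
      (𝓝 (damping d (d + 1) q * fourierPhase x q)) := by
  have hcont := hh.contDiff.continuous
  have hlim : damping d (d + 1) q * fourierPhase x q = ∫ s, damping d (K + (d + 1)) q *
      (fourierPhase x q * (damping d K q)⁻¹ * (h s : ℂ)) := by
    rw [integral_const_mul, integral_const_mul, integral_complex_ofReal, hh.integral_eq_one]
    have h1 := damping_ne_zero K q
    have h2 : damping d (K + (d + 1)) q = damping d K q * damping d (d + 1) q := by
      simp only [damping_eq_ofReal, realDamping_add, Complex.ofReal_mul]
    rw [h2, Complex.ofReal_one]
    field_simp
  rw [hlim]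
  have hev : ∀ᶠ ε : ℝ in 𝓝[>] 0, 0 < ε ∧ ε ≤ 1 := by
    filter_upwards [Ioc_mem_nhdsGT (zero_lt_one' ℝ)] with ε hε using hε
  refine Tendsto.congr' (hev.mono fun ε hε => (integral_modeSymbol_eq hε.1 K x q).symm) ?_
  have hF : Continuous fun z : ℝ × EuclideanSpace ℝ (Fin d) => damping d (K + (d + 1)) q *
      (fourierPhase x (z.1 • z.2 + q) * (damping d K (z.1 • z.2 + q))⁻¹ * (h z.2 : ℂ)) := by
    have hz : Continuous fun z : ℝ × EuclideanSpace ℝ (Fin d) => z.1 • z.2 + q := by fun_prop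
    exact continuous_const.mul (((continuous_fourierPhase.comp (continuous_const.prodMk hz)).mul
      (((continuous_damping K).comp hz).inv₀ fun z => damping_ne_zero K _)).mul
      (Complex.continuous_ofReal.comp (hcont.comp continuous_snd)))
  refine tendsto_integral_filter_of_dominated_convergence
    (fun s => (2 * (1 + ‖s‖ ^ 2)) ^ K * ‖h s‖)
    (Eventually.of_forall fun ε => (hF.comp (Continuous.prodMk_right ε)).aestronglyMeasurable)
    (hev.mono fun ε hε => Eventually.of_forall
      (norm_modeSymbol_substituted_le hε.1 hε.2 K x q))
    (hh.integrable_weight K) (Eventually.of_forall fun s => ?_)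
  have h0 := (hF.comp (Continuous.prodMk_left s)).tendsto 0
  simp only [Function.comp_def, zero_smul, zero_add] at h0
  exact h0.mono_left nhdsWithin_le_nhds

end Symbols

namespace SpectralResolution

variable {H : Type*} [NormedAddCommGroup H] [InnerProductSpace ℂ H] [CompleteSpace H] {d : ℕ}
  {B : LinearMap.BilinForm ℝ (EuclideanSpace ℝ (Fin d))} {U : TranslationRep d H}
  (E : SpectralResolution B U) {h : EuclideanSpace ℝ (Fin d) → ℝ}

lemma integral_modeSymbol (hh : IsMollifier h) (ε : ℝ) (K : ℕ) (x p : EuclideanSpace ℝ (Fin d)) :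
    E.integral (modeSymbol h ε K x p) = (fourierPhase x p * (damping d K p)⁻¹) •
      (E.integral (mollify h ε p) * E.integral (damping d (K + (d + 1)))) := by
  obtain ⟨C, -, hC⟩ := hh.exists_norm_mollify_le ε
  have hm := hh.measurable_mollify ε p
  rw [← ProjectionValuedMeasure.integral_mul hm (hC p) (measurable_damping _) (norm_damping_le _),
    ← ProjectionValuedMeasure.integral_const_mul_eq
      (f := fun q => mollify h ε p q * damping d (K + (d + 1)) q)
      (hm.mul (measurable_damping _)) (C := C * 1) (fun q => by
        rw [norm_mul]
        exact mul_le_mul (hC p q) (norm_damping_le _ q) (norm_nonneg _)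
          ((norm_nonneg _).trans (hC p q)))]
  rfl

/-- For each Fourier mode, the integral over `p` can be taken inside the spectral integral. -/
lemma integral_integral_modeSymbol (hh : IsMollifier h) {ε : ℝ} (hε : 0 < ε) (K : ℕ)
    (x : EuclideanSpace ℝ (Fin d)) : Integrable (fun p => E.integral (modeSymbol h ε K x p)) ∧
      ∫ p, E.integral (modeSymbol h ε K x p) = E.integral fun q => ∫ p, modeSymbol h ε K x p q := by
  obtain ⟨C, hC0, hC⟩ := hh.exists_norm_modeSymbol_le hε K
  have hcont : Continuous fun p => E.integral (modeSymbol h ε K x p) := by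
    simp only [E.integral_modeSymbol hh]
    exact ((continuous_fourierPhase.comp (Continuous.prodMk_right x)).mul
      ((continuous_damping K).inv₀ fun p => damping_ne_zero K p)).smul
      ((E.continuous_integral_mollify hh hε).mul continuous_const)
  have hc := (integrable_realDamping (Nat.lt_succ_self d)).const_mul C
  refine ⟨hc.mono' hcont.aestronglyMeasurable (Eventually.of_forall fun p =>
    ProjectionValuedMeasure.norm_integral_le
      ((hh.measurable_modeSymbol ε K x).comp measurable_prodMk_left)
      (mul_nonneg hC0 (realDamping_pos _ p).le) (hC x p)), ?_⟩
  exact (ProjectionValuedMeasure.isIntegral_integral_param (hh.measurable_modeSymbol ε K x)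
    hc (hC x) hcont.aestronglyMeasurable).integral_eq.symm

variable (Q : Matrix (Fin d) (Fin d) ℝ)

/-- The Fourier representation of `p ↦ α_{Qp}(S)` for a smooth operator `S`. -/
lemma exists_fourier_representation_conj {S : H →L[ℂ] H} (hS : U.IsSmoothOp S) :
    ∃ (K : ℕ) (g : EuclideanSpace ℝ (Fin d) → H →L[ℂ] H), Continuous g ∧ Integrable g ∧
      ∀ p, U.conj (Matrix.toEuclideanLin Q p) S =
        ∫ x, (fourierPhase x p * (damping d K p)⁻¹) • g x := by
  let L : EuclideanSpace ℝ (Fin d) →L[ℝ] EuclideanSpace ℝ (Fin d) :=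
    LinearMap.toContinuousLinearMap (Matrix.toEuclideanLin Q)
  refine exists_fourier_representation (f := fun p => U.conj (L p) S)
    (ContDiff.comp (g := fun x => U.conj x S) hS L.contDiff) fun n =>
      ⟨‖iteratedFDeriv ℝ n (fun x => U.conj x S) 0‖ * ∏ _i : Fin n, ‖L‖, fun p => ?_⟩
  have h1 := L.iteratedFDeriv_comp_right (f := fun x => U.conj x S) (n := ∞) hS p (i := n)
    (by exact_mod_cast le_top)
  change ‖iteratedFDeriv ℝ n ((fun x => U.conj x S) ∘ L) p‖ ≤ _
  rw [h1]
  refine (ContinuousMultilinearMap.norm_compContinuousLinearMap_le _ _).trans ?_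
  exact mul_le_mul_of_nonneg_right (hS.norm_iteratedFDeriv_le n _)
    (Finset.prod_nonneg fun _ _ => norm_nonneg _)

/-- Fourier expansion of the regularized left integral. -/
lemma integral_left_eq (hh : IsMollifier h) {ε : ℝ} (hε : 0 < ε) {K : ℕ}
    {f g : EuclideanSpace ℝ (Fin d) → H →L[ℂ] H} (hgc : Continuous g) (hgi : Integrable g)
    (hf : ∀ p, f p = ∫ x, (fourierPhase x p * (damping d K p)⁻¹) • g x) (w : H) :
    Integrable (fun x => g x (E.integral (fun q => ∫ p, modeSymbol h ε K x p q) w)) ∧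
    ∫ p, f p (E.integral (mollify h ε p) (E.integral (damping d (K + (d + 1))) w)) =
      ∫ x, g x (E.integral (fun q => ∫ p, modeSymbol h ε K x p q) w) := by
  obtain ⟨C, hC0, hC⟩ := hh.exists_norm_modeSymbol_le hε K
  have hc := (integrable_realDamping (Nat.lt_succ_self d)).const_mul C
  let Φ : EuclideanSpace ℝ (Fin d) → EuclideanSpace ℝ (Fin d) → H := fun p x =>
    g x (E.integral (modeSymbol h ε K x p) w)
  have hΦc : Continuous (Function.uncurry Φ) := by
    simp only [Φ, Function.uncurry_def, E.integral_modeSymbol hh]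
    refine (hgc.comp continuous_snd).clm_apply (Continuous.clm_apply ?_ continuous_const)
    exact ((continuous_fourierPhase.comp (continuous_snd.prodMk continuous_fst)).mul
      (((continuous_damping K).comp continuous_fst).inv₀ fun p => damping_ne_zero K _)).smul
      (((E.continuous_integral_mollify hh hε).comp continuous_fst).mul continuous_const)
  have hΦi : Integrable (Function.uncurry Φ) (volume.prod volume) := by
    refine ((hc.mul_const ‖w‖).mul_prod hgi.norm).mono' hΦc.aestronglyMeasurable
      (Eventually.of_forall fun z => ?_)
    rw [mul_comm]
    refine ((g z.2).le_opNorm _).trans (mul_le_mul_of_nonneg_left ?_ (norm_nonneg _))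
    exact ProjectionValuedMeasure.norm_integral_apply_le
      ((hh.measurable_modeSymbol ε K z.2).comp measurable_prodMk_left)
      (mul_nonneg hC0 (realDamping_pos _ z.1).le) (hC z.2 z.1) w
  have hleft : ∀ p, f p (E.integral (mollify h ε p) (E.integral (damping d (K + (d + 1))) w)) =
      ∫ x, Φ p x := fun p => by
    have hi : Integrable fun x => (fourierPhase x p * (damping d K p)⁻¹) • g x := by
      refine (hgi.norm.const_mul ‖(damping d K p)⁻¹‖).mono'
        (((continuous_fourierPhase.comp (Continuous.prodMk_left p)).mul
          continuous_const).smul hgc).aestronglyMeasurable (Eventually.of_forall fun x => ?_)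
      rw [norm_smul, norm_mul, norm_fourierPhase, one_mul]
    rw [hf p, ContinuousLinearMap.integral_apply hi]
    congr 1
    ext x
    simp only [Φ]
    rw [E.integral_modeSymbol hh, smul_apply, smul_apply, _root_.map_smul, mul_apply_eq_comp]
  have hright : ∀ x, ∫ p, Φ p x =
      g x (E.integral (fun q => ∫ p, modeSymbol h ε K x p q) w) := fun x => by
    obtain ⟨hi, he⟩ := E.integral_integral_modeSymbol hh hε K x
    simp only [Φ]
    rw [← he, ContinuousLinearMap.integral_apply hi]
    exact (g x).integral_comp_comm (hi.apply_continuousLinearMap w)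
  refine ⟨?_, ?_⟩
  · have := hΦi.integral_prod_right
    simpa only [Function.uncurry_apply_pair, hright] using this
  · simp_rw [hleft]
    rw [integral_integral_swap hΦi]
    simp_rw [hright]

/-- On sufficiently damped vectors the regularized left integrals converge, to a limit that does
not depend on the mollifier. -/
lemma exists_tendsto_left {S : H →L[ℂ] H} (hS : U.IsSmoothOp S) :
    ∃ L : ℕ, ∀ w : H, ∃ z : H, ∀ h : EuclideanSpace ℝ (Fin d) → ℝ, IsMollifier h →
      Tendsto (fun ε => ∫ p, U.conj (Matrix.toEuclideanLin Q p) S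
        (E.integral (mollify h ε p) (E.integral (damping d L) w))) (𝓝[>] 0) (𝓝 z) := by
  obtain ⟨K, g, hgc, hgi, hg⟩ := exists_fourier_representation_conj Q hS
  refine ⟨K + (d + 1), fun w =>
    ⟨∫ x, g x (E.integral (fun q => damping d (d + 1) q * fourierPhase x q) w), fun h hh => ?_⟩⟩
  set C := ∫ s : EuclideanSpace ℝ (Fin d), (2 * (1 + ‖s‖ ^ 2)) ^ K * ‖h s‖
  have hC0 : 0 ≤ C := integral_nonneg fun s => by positivity
  have hev : ∀ᶠ ε : ℝ in 𝓝[>] 0, 0 < ε ∧ ε ≤ 1 := by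
    filter_upwards [Ioc_mem_nhdsGT (zero_lt_one' ℝ)] with ε hε using hε
  have hmeas : ∀ ε x, Measurable fun q => ∫ p, modeSymbol h ε K x p q := fun ε x =>
    (StronglyMeasurable.integral_prod_left
      (hh.measurable_modeSymbol ε K x).stronglyMeasurable).measurable
  refine Tendsto.congr' (hev.mono fun ε hε => (E.integral_left_eq hh hε.1 hgc hgi hg w).2.symm) ?_
  refine tendsto_integral_filter_of_dominated_convergence (fun x => ‖g x‖ * (C * ‖w‖))
    (hev.mono fun ε hε => (E.integral_left_eq hh hε.1 hgc hgi hg w).1.aestronglyMeasurable)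
    (hev.mono fun ε hε => Eventually.of_forall fun x => ?_) (hgi.norm.mul_const _)
    (Eventually.of_forall fun x => ((g x).continuous.tendsto _).comp ?_)
  · refine ((g x).le_opNorm _).trans (mul_le_mul_of_nonneg_left ?_ (norm_nonneg _))
    exact ProjectionValuedMeasure.norm_integral_apply_le (hmeas ε x) hC0
      (hh.norm_integral_modeSymbol_le hε.1 hε.2 K x) w
  · refine ProjectionValuedMeasure.tendsto_integral_apply_of_eventually (C := C + 1)
      (Eventually.of_forall fun ε => hmeas ε x)
      ((measurable_damping _).mul (continuous_fourierPhase.comp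
        (Continuous.prodMk_right x)).measurable)
      (hev.mono fun ε hε q => (hh.norm_integral_modeSymbol_le hε.1 hε.2 K x q).trans
        (by linarith)) (fun q => ?_) (hh.tendsto_integral_modeSymbol K x) w
    change ‖damping d (d + 1) q * fourierPhase x q‖ ≤ C + 1
    rw [norm_mul, norm_fourierPhase, mul_one]
    linarith [norm_damping_le (d + 1) q]

end SpectralResolution

end WarpedConvolution

end

/-! ### The warped integrals -/

theorem lemma1 {H : Type*} [NormedAddCommGroup H] [InnerProductSpace ℂ H] [CompleteSpace H]
    [TopologicalSpace.SeparableSpace H] {d : ℕ} (hd : 2 ≤ d)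
    (B : LinearMap.BilinForm ℝ (EuclideanSpace ℝ (Fin d))) (hB : B.IsSymm) (hB' : B.Nondegenerate)
    (U : WarpedConvolution.TranslationRep d H) (E : WarpedConvolution.SpectralResolution B U)
    (Q : Matrix (Fin d) (Fin d) ℝ)
    (hQ : ∀ p q : EuclideanSpace ℝ (Fin d),
      B q (Matrix.toEuclideanLin Q p) = -B p (Matrix.toEuclideanLin Q q))
    (F : H →ₗ.[ℂ] H) (hF : WarpedConvolution.IsTranslationSmooth E F) :
    ∃ G : U.smoothVectors →ₗ[ℂ] H,
      WarpedConvolution.HasLeftIntegral E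
        (WarpedConvolution.warpedIntegrand U Q F hF.le_domain) G ∧
      WarpedConvolution.HasRightIntegral E
        (WarpedConvolution.warpedIntegrand U Q F hF.le_domain) G := by
  open WarpedConvolution in
  obtain ⟨N, S, hS, hSF⟩ := E.exists_isSmoothOp_eq hB hB' hF
  obtain ⟨L, hL⟩ := E.exists_tendsto_left Q hS
  set A := warpedIntegrand U Q F hF.le_domain
  -- on vectors `rᴺ w` with smooth `w`, the operator `F` acts as the bounded operator `S` on `w`
  have hJ : ∀ v : U.smoothVectors, ∃ w : U.smoothVectors,
      E.onSmooth (fun p => resolventProd d p ^ N) w = v := fun v => by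
    obtain ⟨w, hw, h⟩ := (E.isRegularizer_resolventProd_pow hB hB' N).exists_apply_eq v v.2
    exact ⟨⟨w, hw⟩, Subtype.ext h⟩
  choose J hJ using hJ
  have hr : ∀ p v, A p v = U.conj (Matrix.toEuclideanLin Q p) S (J v) := fun p v => by
    conv_lhs => rw [← hJ v]
    exact hSF _ _
  have hl : ∀ h, IsMollifier h → ∀ ε p v, A p (E.onSmooth (mollify h ε p) v) =
      U.conj (Matrix.toEuclideanLin Q p) S (E.integral (mollify h ε p) (J v)) := by
    intro h hh ε p v
    obtain ⟨C, -, hC⟩ := hh.exists_norm_mollify_le ε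
    have hcomm := E.integral_mul_comm (hh.measurable_mollify ε p) (hC p)
      (measurable_resolventProd.pow_const N) (SpectralResolution.norm_resolventProd_pow_le N)
    have h1 : E.onSmooth (mollify h ε p) v = E.onSmooth (fun p => resolventProd d p ^ N)
        (E.onSmooth (mollify h ε p) (J v)) := by
      conv_lhs => rw [← hJ v]
      exact Subtype.ext (congrArg (fun T : H →L[ℂ] H => T (J v : H)) hcomm)
    rw [h1]
    exact hSF _ _
  have hli : ∀ h, IsMollifier h → ∀ ε > 0, ∀ v,
      Integrable fun p => A p (E.onSmooth (mollify h ε p) v) := fun h hh ε hε v => by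
    simp only [hl h hh]
    exact E.integrable_left Q hB hB' hS hh hε (J v).2
  have hlim : ∀ v, ∃ z, ∀ h, IsMollifier h →
      Tendsto (fun ε => ∫ p, A p (E.onSmooth (mollify h ε p) v)) (𝓝[>] 0) (𝓝 z) := fun v => by
    obtain ⟨w, -, hw⟩ := E.exists_damping_eq hB hB' L (J v).2
    obtain ⟨z, hz⟩ := hL w
    refine ⟨z, fun h hh => ?_⟩
    simp only [hl h hh, ← hw]
    exact hz h hh
  choose z hz using hlim
  obtain ⟨h₀, hh₀⟩ := exists_isMollifier d
  let G : U.smoothVectors →ₗ[ℂ] H :=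
    { toFun := z
      map_add' := fun v w => by
        refine tendsto_nhds_unique (hz (v + w) h₀ hh₀)
          (((hz v h₀ hh₀).add (hz w h₀ hh₀)).congr' ?_)
        filter_upwards [self_mem_nhdsWithin] with ε hε
        rw [← integral_add (hli h₀ hh₀ ε hε v) (hli h₀ hh₀ ε hε w)]
        simp only [map_add]
      map_smul' := fun c v => by
        refine tendsto_nhds_unique (hz (c • v) h₀ hh₀)
          (((hz v h₀ hh₀).const_smul c).congr' ?_)
        filter_upwards [self_mem_nhdsWithin] with ε hε
        rw [← integral_smul]
        simp only [map_smul] }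
  -- the right integral has the same limit since it equals the left one for every `ε`
  refine ⟨G, fun h hh v => ⟨fun ε hε => hli h hh ε hε v, hz v h hh⟩, fun h hh v => ⟨fun ε hε => ?_,
    (hz v h hh).congr' ?_⟩⟩
  · simp only [hr]
    exact E.integrable_right Q hB hB' hS hh hε (J v).2
  · filter_upwards [self_mem_nhdsWithin] with ε hε
    simp only [hl h hh, hr]
    exact E.integral_left_eq_right hB hB' hQ hS hh hε (J v).2
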